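/- A \emph{cofibration category} is a category $\mathcal C$ with two classes of morphisms, cofibrations and weak equivalences, such that: (C1) all isomorphisms are cofibrations and weak equivalences, cofibrations are closed under composition, $\mathcal C$ has an initial object and every morphism out of an initial object is a cofibration; (C2) if two of $f$, $g$, $gf$ are weak equivalences, so is the third; (C3) for every cofibration $i:A\to B$ and every morphism $f:A\to C$ a pushout $P=B\cup_A C$ exists and $j:C\to P$ is a cofibration, which is a weak equivalence if $i$ is; (C4) every morphism factors as a cofibration followed by a weak equivalence. A functor between cofibration categories is \emph{exact} if it preserves initial objects, cofibrations, weak equivalences and pushouts along cofibrations. $\mathbf{Ho}(\mathcal C)$ denotes the localization $\gamma:\mathcal C\to\mathbf{Ho}(\mathcal C)$ at the weak equivalences (possibly with large hom-sets), and the \emph{derived functor} of an exact functor $F:\mathcal C\to\mathcal D$ is the unique functor $\mathbf{Ho}(F):\mathbf{Ho}(\mathcal C)\to\mathbf{Ho}(\mathcal D)$ with $\mathbf{Ho}(F)\circ\gamma^{\mathcal C}=\gamma^{\mathcal D}\circ F$. Let $\Delta$ be the category of the ordered sets $[n]=\{0<\dots<n\}$, $n\ge 0$, and injective monotone maps. A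 \emph{co-$\Delta$-object} of $\mathcal C$ is a functor $A:\Delta\to\mathcal C$, $A^n=A([n])$; morphisms are natural transformations. Its $n$-th latching object $\partial^n\!A$, if it exists, is the colimit of $([i]\to[n])\mapsto A^i$ over the full subcategory of the over category $\Delta\downarrow[n]$ on the objects $[i]\to[n]$ with $i<n$; let $\nu^n:\partial^n\!A\to A^n$ be the canonical morphism. $A$ is \emph{cofibrant} if for all $n\ge 0$ the object $\partial^n\!A$ exists and $\nu^n$ is a cofibration. A morphism $f:A\to B$ of cofibrant co-$\Delta$-objects is a \emph{cofibration} if for all $n\ge 0$ the induced morphism $A^n\cup_{\partial^n\!A}\partial^n\!B\to B^n$ is a cofibration. A morphism $f$ of co-$\Delta$-objects is a \emph{level equivalence} if every $f^n$ is a weak equivalence. A \emph{frame} in $\mathcal C$ is a cofibrant co-$\Delta$-object $A$ such that $\alpha_*:A^n\to A^m$ is a weak equivalence for every morphism $\alpha:[n]\to[m]$ of $\Delta$. \textbf{Theorem.} Let $\mathcal C$ be a cofibration category. Then the full subcategory $f\mathcal C$ of frames in the category of co-$\Delta$-objects of $\mathcal C$ is a cofibration category with respect to the above cofibrations and level equivalences.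 The functor $f\mathcal C\to\mathcal C$, $A\mapsto A^0$, that evaluates in dimension $0$ is exact, and its derived functor $\mathbf{Ho}(f\mathcal C)\to\mathbf{Ho}(\mathcal C)$ is an equivalence of categories. -/

import Mathlib

open CategoryTheory CategoryTheory.Limits

universe v v' u u'

/-! ### Cofibration categories -/

/-- A category `C` with two classes of morphisms `cof` (the cofibrations) and `weq` (the weak
equivalences) is a cofibration category. -/
structure IsCofibrationCategory {C : Type u} [Category.{v} C] (cof weq : MorphismProperty C) :
    Prop where
  /-- all isomorphisms are cofibrations -/
  cof_of_isIso : ∀ ⦃X Y : C⦄ (f : X ⟶ Y), IsIso f → cof f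
  /-- all isomorphisms are weak equivalences -/
  weq_of_isIso : ∀ ⦃X Y : C⦄ (f : X ⟶ Y), IsIso f → weq f
  /-- cofibrations are stable under composition -/
  cof_comp : ∀ ⦃X Y Z : C⦄ (f : X ⟶ Y) (g : Y ⟶ Z), cof f → cof g → cof (f ≫ g)
  /-- there is an initial object -/
  hasInitial : HasInitial C
  /-- every morphism from an initial object is a cofibration -/
  cof_of_isInitial : ∀ ⦃X Y : C⦄ (f : X ⟶ Y), Nonempty (IsInitial X) → cof f
  /-- weak equivalences satisfy two out of three -/
  two_out_of_three : weq.HasTwoOutOfThreeProperty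
  /-- pushouts along cofibrations exist; cofibrations and acyclic cofibrations are stable under
  these cobase changes -/
  exists_pushout : ∀ ⦃A B C' : C⦄ (i : A ⟶ B) (f : A ⟶ C'), cof i →
    ∃ (P : C) (j : C' ⟶ P) (g : B ⟶ P), IsPushout f i j g ∧ cof j ∧ (weq i → weq j)
  /-- every morphism is a cofibration followed by a weak equivalence -/
  exists_factorization : ∀ ⦃X Y : C⦄ (f : X ⟶ Y),
    ∃ (Z : C) (i : X ⟶ Z) (p : Z ⟶ Y), cof i ∧ weq p ∧ i ≫ p = f

/-- A functor between cofibration categories is exact if it preserves initial objects,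
cofibrations, weak equivalences, and pushouts along cofibrations. -/
structure IsExactFunctor {C : Type u} [Category.{v} C] {D : Type u'} [Category.{v'} D]
    (cof weq : MorphismProperty C) (cof' weq' : MorphismProperty D) (F : C ⥤ D) : Prop where
  map_initial : ∀ X : C, Nonempty (IsInitial X) → Nonempty (IsInitial (F.obj X))
  map_cof : ∀ ⦃X Y : C⦄ (f : X ⟶ Y), cof f → cof' (F.map f)
  map_weq : ∀ ⦃X Y : C⦄ (f : X ⟶ Y), weq f → weq' (F.map f)
  map_pushout : ∀ ⦃A B C' P : C⦄ (f : A ⟶ C') (i : A ⟶ B) (j : C' ⟶ P) (g : B ⟶ P),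
    cof i → IsPushout f i j g → IsPushout (F.map f) (F.map i) (F.map j) (F.map g)

/-- The homotopy category: the localization of `C` at the class of weak equivalences.
The localization functor is `weq.Q`. -/
abbrev HomotopyCat {C : Type u} [Category.{v} C] (weq : MorphismProperty C) :=
  weq.Localization

/-- The functor induced on homotopy categories by a functor preserving weak equivalences. -/
noncomputable def derivedFunctor {C : Type u} [Category.{v} C] {D : Type u'} [Category.{v'} D]
    {weq : MorphismProperty C} {weq' : MorphismProperty D} (F : C ⥤ D)
    (hF : ∀ ⦃X Y : C⦄ (f : X ⟶ Y), weq f → weq' (F.map f)) :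
    HomotopyCat weq ⥤ HomotopyCat weq' :=
  Localization.Construction.lift (F ⋙ weq'.Q)
    (fun _ _ f hf => weq'.Q_inverts (F.map f) (hF f hf))

/-- The derived functor is the unique functor compatible with the localization functors. -/
theorem eq_derivedFunctor_iff {C : Type u} [Category.{v} C] {D : Type u'} [Category.{v'} D]
    {weq : MorphismProperty C} {weq' : MorphismProperty D} (F : C ⥤ D)
    (hF : ∀ ⦃X Y : C⦄ (f : X ⟶ Y), weq f → weq' (F.map f))
    (G : HomotopyCat weq ⥤ HomotopyCat weq') :
    G = derivedFunctor F hF ↔ weq.Q ⋙ G = F ⋙ weq'.Q := by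
  have h : weq.Q ⋙ derivedFunctor F hF = F ⋙ weq'.Q := Localization.Construction.fac _ _
  exact ⟨fun e => e ▸ h, fun e => Localization.Construction.uniq _ _ (e.trans h.symm)⟩

/-! ### Co-`Δ`-objects -/

/-- The category `Δ`: its objects are the ordered sets `[n] = {0 < 1 < ... < n}`, its morphisms
are the injective monotone maps. -/
structure InjDelta : Type where
  /-- the natural number `n` of the object `[n]` -/
  len : ℕ

instance : Category.{0} InjDelta where
  Hom m n := Fin (m.len + 1) ↪o Fin (n.len + 1)
  id m := RelEmbedding.refl _
  comp f g := RelEmbedding.trans f g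

/-- Co-`Δ`-objects in `C`, with natural transformations as morphisms. -/
abbrev CoDelta (C : Type u) [Category.{v} C] := InjDelta ⥤ C

/-- The simplex category of the boundary `∂Δ[n]`: the full subcategory of the over category
`Δ ↓ [n]` on all `[i] ⟶ [n]` with `i < n`. -/
abbrev BoundaryIndex (n : InjDelta) :=
  ObjectProperty.FullSubcategory (fun α : Over n => α.left.len < n.len)

section Latching

variable {C : Type u} [Category.{v} C]

/-- The diagram `([i] ⟶ [n]) ↦ A^i` whose colimit is the `n`-th latching object. -/
abbrev latchingDiagram (A : CoDelta C) (n : InjDelta) : BoundaryIndex n ⥤ C :=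
  ObjectProperty.ι _ ⋙ Over.forget n ⋙ A

/-- The cocone with vertex `A^n` given by the structure morphisms `α_* : A^i ⟶ A^n`. -/
@[simps]
def latchingCocone (A : CoDelta C) (n : InjDelta) : Cocone (latchingDiagram A n) where
  pt := A.obj n
  ι :=
    { app := fun α => A.map α.obj.hom
      naturality := fun α β f => by
        simp [← Functor.map_comp] }

/-- An `n`-th latching object `∂ⁿA` of `A`, together with its universal morphisms. -/
abbrev LatchingObject (A : CoDelta C) (n : InjDelta) := ColimitCocone (latchingDiagram A n)

/-- The canonical morphism `νⁿ : ∂ⁿA ⟶ Aⁿ`. -/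
def latchingMap {A : CoDelta C} {n : InjDelta} (L : LatchingObject A n) :
    L.cocone.pt ⟶ A.obj n :=
  L.isColimit.desc (latchingCocone A n)

theorem ι_latchingMap {A : CoDelta C} {n : InjDelta} (L : LatchingObject A n)
    (α : BoundaryIndex n) : L.cocone.ι.app α ≫ latchingMap L = A.map α.obj.hom :=
  L.isColimit.fac (latchingCocone A n) α

/-- The morphism of latching diagrams induced by `f : A ⟶ B`. -/
@[simps]
def latchingDiagramMap {A B : CoDelta C} (f : A ⟶ B) (n : InjDelta) :
    latchingDiagram A n ⟶ latchingDiagram B n where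
  app := fun α => f.app α.obj.left

/-- The morphism `∂ⁿf : ∂ⁿA ⟶ ∂ⁿB` induced by `f : A ⟶ B`. -/
def latchingObjectMap {A B : CoDelta C} (f : A ⟶ B) {n : InjDelta}
    (L : LatchingObject A n) (M : LatchingObject B n) : L.cocone.pt ⟶ M.cocone.pt :=
  L.isColimit.map M.cocone (latchingDiagramMap f n)

theorem ι_latchingObjectMap {A B : CoDelta C} (f : A ⟶ B) {n : InjDelta}
    (L : LatchingObject A n) (M : LatchingObject B n) (α : BoundaryIndex n) :
    L.cocone.ι.app α ≫ latchingObjectMap f L M = f.app α.obj.left ≫ M.cocone.ι.app α :=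
  L.isColimit.ι_map M.cocone (latchingDiagramMap f n) α

theorem latchingMap_naturality {A B : CoDelta C} (f : A ⟶ B) {n : InjDelta}
    (L : LatchingObject A n) (M : LatchingObject B n) :
    latchingMap L ≫ f.app n = latchingObjectMap f L M ≫ latchingMap M := by
  refine L.isColimit.hom_ext fun α => ?_
  have h₁ : L.cocone.ι.app α ≫ latchingMap L ≫ f.app n = A.map α.obj.hom ≫ f.app n :=
    (Category.assoc _ _ _).symm.trans (congrArg (fun g => g ≫ f.app n) (ι_latchingMap L α))
  have h₂ : L.cocone.ι.app α ≫ latchingObjectMap f L M ≫ latchingMap M =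
      f.app α.obj.left ≫ B.map α.obj.hom :=
    (Category.assoc _ _ _).symm.trans
      ((congrArg (fun g => g ≫ latchingMap M) (ι_latchingObjectMap f L M α)).trans
        ((Category.assoc _ _ _).trans
          (congrArg (fun g => f.app α.obj.left ≫ g) (ι_latchingMap M α))))
  exact h₁.trans ((f.naturality α.obj.hom).trans h₂.symm)

/-- A co-`Δ`-object is cofibrant if all latching objects exist and all `νⁿ` are cofibrations. -/
def IsCofibrantCoDelta (cof : MorphismProperty C) (A : CoDelta C) : Prop :=
  ∀ n : InjDelta, ∃ L : LatchingObject A n, cof (latchingMap L)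

/-- A morphism of cofibrant co-`Δ`-objects is a cofibration if for all `n` the morphism
`fⁿ ∪ νⁿ : Aⁿ ∪_{∂ⁿA} ∂ⁿB ⟶ Bⁿ` is a cofibration. -/
def coDeltaCofibrations (cof : MorphismProperty C) : MorphismProperty (CoDelta C) :=
  fun A B f => ∀ n : InjDelta,
    ∃ (L : LatchingObject A n) (M : LatchingObject B n) (P : C)
      (inl : A.obj n ⟶ P) (inr : M.cocone.pt ⟶ P)
      (h : IsPushout (latchingMap L) (latchingObjectMap f L M) inl inr),
      cof (h.desc (f.app n) (latchingMap M) (latchingMap_naturality f L M))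

/-- Level equivalences of co-`Δ`-objects. -/
def levelEquivalences (weq : MorphismProperty C) : MorphismProperty (CoDelta C) :=
  fun _ _ f => ∀ n : InjDelta, weq (f.app n)

/-- Frames: cofibrant co-`Δ`-objects that are homotopically constant. -/
def IsFrame (cof weq : MorphismProperty C) : ObjectProperty (CoDelta C) :=
  fun A => IsCofibrantCoDelta cof A ∧ ∀ ⦃m n : InjDelta⦄ (α : m ⟶ n), weq (A.map α)

/-- The full subcategory of frames. -/
abbrev FrameCat (cof weq : MorphismProperty C) := (IsFrame cof weq).FullSubcategory

/-- The cofibrations between frames. -/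
def frameCofibrations (cof weq : MorphismProperty C) : MorphismProperty (FrameCat cof weq) :=
  (coDeltaCofibrations cof).inverseImage (IsFrame cof weq).ι

/-- The level equivalences between frames. -/
def frameEquivalences (cof weq : MorphismProperty C) : MorphismProperty (FrameCat cof weq) :=
  (levelEquivalences weq).inverseImage (IsFrame cof weq).ι

/-- The functor `A ↦ A⁰` that evaluates a frame in dimension `0`. -/
def frameEvalZero (cof weq : MorphismProperty C) : FrameCat cof weq ⥤ C :=
  (IsFrame cof weq).ι ⋙ (evaluation InjDelta C).obj ⟨0⟩

end Latching

-- The cofibration structure. A sieve on `[n]` is a subcomplex of the simplex `Δ[n]`, and adding its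
-- faces one at a time turns a colimit of a co-`Δ`-object over a sieve into an iterated pushout
-- along latching maps (`IsFaceColimit.attach`). Hence latching objects exist as soon as the lower
-- latching maps are cofibrations, and a cofibration of cofibrant co-`Δ`-objects is a cofibration on
-- latching objects and in every dimension. Pushouts along cofibrations can therefore be formed
-- dimensionwise: relative latching maps are preserved under cobase change, and the gluing lemma
-- `weq_pushout_map` keeps the result homotopically constant. A factorization is obtained by
-- correcting the target in one dimension after another. The resulting tower is constant in each
-- dimension from some stage on, so its limit exists without any completeness assumption.
--
-- The equivalence. Between frames and `C` lies the category of all homotopically constant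
-- co-`Δ`-objects, cofibrant or not. There, evaluation in dimension `0` has a section, the constant
-- objects, and `A` is joined to the constant object on `A⁰` by natural level equivalences `A⁰ ⟶
-- A([0] ⋆ [n]) ⟵ Aⁿ`, induced by the cone point and the base of the cone. To return to frames, each
-- homotopically constant object is replaced by a frame mapping to it by a level equivalence; the
-- choice is functorial with values in the homotopy category of frames (`approxFunctor`). Constant
-- objects followed by this replacement induce the inverse of the derived functor.

universe v'' u''

/-! ### Cobase change and the gluing lemma in a cofibration category -/

namespace IsCofibrationCategory

variable {C : Type u} [Category.{v} C] {cof weq : MorphismProperty C}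

section

variable (hC : IsCofibrationCategory cof weq)
include hC

theorem weq_comp {X Y Z : C} {f : X ⟶ Y} {g : Y ⟶ Z} (hf : weq f) (hg : weq g) :
    weq (f ≫ g) :=
  have := hC.two_out_of_three
  weq.comp_mem f g hf hg

theorem weq_of_precomp {X Y Z : C} {f : X ⟶ Y} {g : Y ⟶ Z} (hf : weq f) (hfg : weq (f ≫ g)) :
    weq g :=
  have := hC.two_out_of_three
  weq.of_precomp f g hf hfg

theorem weq_of_postcomp {X Y Z : C} {f : X ⟶ Y} {g : Y ⟶ Z} (hg : weq g) (hfg : weq (f ≫ g)) :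
    weq f :=
  have := hC.two_out_of_three
  weq.of_postcomp f g hg hfg

theorem weq_id (X : C) : weq (𝟙 X) := hC.weq_of_isIso _ inferInstance

/-- The axiom speaks of some pushout only; any other one differs from it by an isomorphism. -/
theorem cof_of_isPushout {A B C' P : C} {f : A ⟶ C'} {i : A ⟶ B} {j : C' ⟶ P} {g : B ⟶ P}
    (h : IsPushout f i j g) (hi : cof i) : cof j := by
  obtain ⟨P', j', g', h', hj', -⟩ := hC.exists_pushout i f hi
  rw [← h'.inl_isoIsPushout_hom _ _ h]
  exact hC.cof_comp _ _ hj' (hC.cof_of_isIso _ inferInstance)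

theorem weq_of_isPushout {A B C' P : C} {f : A ⟶ C'} {i : A ⟶ B} {j : C' ⟶ P} {g : B ⟶ P}
    (h : IsPushout f i j g) (hi : cof i) (hi' : weq i) : weq j := by
  obtain ⟨P', j', g', h', -, hj'⟩ := hC.exists_pushout i f hi
  rw [← h'.inl_isoIsPushout_hom _ _ h]
  exact hC.weq_comp (hj' hi') (hC.weq_of_isIso _ inferInstance)

theorem hasPushout {A B C' : C} (f : A ⟶ C') (i : A ⟶ B) (hi : cof i) : HasPushout f i :=
  let ⟨_, _, _, h, _⟩ := hC.exists_pushout i f hi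
  h.hasPushout

/-- A morphism of spans induces a cofibration on pushouts if it is a cofibration on one of the feet
and a relative cofibration on the opposite leg. -/
theorem cof_pushout_map {S₁ X₁ Y₁ P₁ S₂ X₂ Y₂ P₂ R : C}
    {b₁ : S₁ ⟶ X₁} {a₁ : S₁ ⟶ Y₁} {j₁ : X₁ ⟶ P₁} {g₁ : Y₁ ⟶ P₁}
    {b₂ : S₂ ⟶ X₂} {a₂ : S₂ ⟶ Y₂} {j₂ : X₂ ⟶ P₂} {g₂ : Y₂ ⟶ P₂}
    (h₁ : IsPushout b₁ a₁ j₁ g₁) (h₂ : IsPushout b₂ a₂ j₂ g₂)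
    {s : S₁ ⟶ S₂} {x : X₁ ⟶ X₂} {y : Y₁ ⟶ Y₂} {p : P₁ ⟶ P₂}
    {inl : Y₁ ⟶ R} {inr : S₂ ⟶ R} (hR : IsPushout a₁ s inl inr) {r : R ⟶ Y₂}
    (hinl : inl ≫ r = y) (hinr : inr ≫ r = a₂) (hb : b₁ ≫ x = s ≫ b₂)
    (hj : j₁ ≫ p = x ≫ j₂) (hg : g₁ ≫ p = y ≫ g₂) (hx : cof x) (hr : cof r) : cof p := by
  -- With `Q = X₂ ∪_{X₁} P₁`, the morphism `p` factors as `P₁ ⟶ Q ⟶ P₂`, a cobase change of `x`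
  -- followed by one of `r`.
  obtain ⟨Q, u, v, h, hu, -⟩ := hC.exists_pushout x j₁ hx
  have e : a₁ ≫ g₁ ≫ u = s ≫ b₂ ≫ v := by
    rw [← reassoc_of% hb, ← h.w, reassoc_of% h₁.w]
  have hl : IsPushout b₂ inr v (hR.desc (g₁ ≫ u) (b₂ ≫ v) e) := by
    refine IsPushout.of_left (h₁₁ := s) (h₂₁ := inl) (v₁₁ := a₁) ?_ (by simp) hR.flip
    simpa [hb] using h₁.paste_horiz h.flip
  have hr' : IsPushout r (hR.desc (g₁ ≫ u) (b₂ ≫ v) e) g₂ (h.desc p j₂ hj) := by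
    refine IsPushout.of_left (h₁₁ := inr) (h₂₁ := v) (v₁₁ := b₂) ?_ ?_ hl.flip
    · simpa [hinr] using h₂.flip
    · apply hR.hom_ext
      · simp [reassoc_of% hinl, hg]
      · simp [reassoc_of% hinr, h₂.w]
  have := hC.cof_comp _ _ hu (hC.cof_of_isPushout hr'.flip hr)
  simpa using this

/-- Brown's factorization lemma. -/
theorem exists_brown_factorization {X Y : C} (f : X ⟶ Y) :
    ∃ (Z : C) (i : X ⟶ Z) (p : Z ⟶ Y) (s : Y ⟶ Z),
      cof i ∧ cof s ∧ weq s ∧ weq p ∧ i ≫ p = f ∧ s ≫ p = 𝟙 Y := by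
  have := hC.hasInitial
  obtain ⟨S, a, b, h, ha, -⟩ := hC.exists_pushout (initial.to Y) (initial.to X)
    (hC.cof_of_isInitial _ ⟨initialIsInitial⟩)
  have hb := hC.cof_of_isPushout h.flip (hC.cof_of_isInitial _ ⟨initialIsInitial⟩)
  obtain ⟨Z, e, p, he, hp, w⟩ := hC.exists_factorization
    (h.desc f (𝟙 Y) (Subsingleton.elim _ _))
  have hs : (b ≫ e) ≫ p = 𝟙 Y := by simp [w]
  exact ⟨Z, a ≫ e, p, b ≫ e, hC.cof_comp _ _ ha he, hC.cof_comp _ _ hb he,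
    hC.weq_of_postcomp hp (hs ▸ hC.weq_id Y), hp, by simp [w], hs⟩

/-- Ken Brown's lemma for the functor that pushes out cofibrations under `A` along `f`. -/
theorem weq_pushout_map_under {A X Y C' X' Y' : C} {x : A ⟶ X} {y : A ⟶ Y} {f : A ⟶ C'}
    {x' : C' ⟶ X'} {u : X ⟶ X'} {y' : C' ⟶ Y'} {v : Y ⟶ Y'}
    (h₁ : IsPushout f x x' u) (h₂ : IsPushout f y y' v) {g : X ⟶ Y} {g' : X' ⟶ Y'}
    (hg : x ≫ g = y) (hx' : x' ≫ g' = y') (hu : u ≫ g' = g ≫ v)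
    (hx : cof x) (hy : cof y) (hw : weq g) : weq g' := by
  -- Brown's factorization relative to `A`: `g` is the cofibration `a ≫ e` followed by `p`, and `p`
  -- has the acyclic cofibration `b ≫ e` as a section. Cobase change preserves both acyclic
  -- cofibrations, and the pushed-out `p'` is a weak equivalence because its section is one.
  obtain ⟨S, a, b, h, ha, -⟩ := hC.exists_pushout y x hy
  have hb := hC.cof_of_isPushout h.flip hx
  obtain ⟨W, e, p, he, hp, w⟩ := hC.exists_factorization (h.desc g (𝟙 Y) (by simp [hg]))
  have hs : (b ≫ e) ≫ p = 𝟙 Y := by simp [w]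
  have ht : (a ≫ e) ≫ p = g := by simp [w]
  have hse : y ≫ b ≫ e = x ≫ a ≫ e := by rw [reassoc_of% h.w]
  obtain ⟨W', t', w', hW, -, ht'⟩ := hC.exists_pushout (a ≫ e) u (hC.cof_comp _ _ ha he)
  have hW' : IsPushout f (y ≫ b ≫ e) (x' ≫ t') w' := hse ▸ h₁.paste_vert hW
  have hY := IsPushout.of_top' hW' h₂
  have hs' := hC.weq_of_isPushout hY (hC.cof_comp _ _ hb he)
    (hC.weq_of_postcomp hp (hs ▸ hC.weq_id Y))
  let p' : W' ⟶ Y' := hW.desc g' (p ≫ v) (by rw [hu, ← ht, Category.assoc])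
  have hp' : weq p' := by
    refine hC.weq_of_precomp hs' ?_
    convert hC.weq_id Y'
    apply h₂.hom_ext
    · simp [p', hx']
    · simp only [Category.assoc] at hs
      simp [p', reassoc_of% hs]
  have : t' ≫ p' = g' := by simp [p']
  rw [← this]
  exact hC.weq_comp (ht' (hC.weq_of_postcomp hp (ht ▸ hw))) hp'

/-- Weak equivalences are stable under cobase change along cofibrations. -/
theorem weq_of_isPushout_cof {A B C' P : C} {f : A ⟶ C'} {i : A ⟶ B} {j : C' ⟶ P} {g : B ⟶ P}
    (h : IsPushout f i j g) (hi : cof i) (hf : weq f) : weq g := by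
  obtain ⟨Z, i₀, p, s, hi₀, hs, hs', hp, rfl, hsp⟩ := hC.exists_brown_factorization f
  have hi₀' := hC.weq_of_postcomp hp hf
  obtain ⟨B₁, j₁, g₁, h₁, hj₁, -⟩ := hC.exists_pushout i i₀ hi
  have h₂ := IsPushout.of_left' h h₁
  have hg₁ := hC.weq_of_isPushout h₁.flip hi₀ hi₀'
  suffices weq (h₁.desc (p ≫ j) g (by rw [← Category.assoc, h.w])) by
    simpa using hC.weq_comp hg₁ this
  generalize h₁.desc (p ≫ j) g _ = g₂ at h₂ ⊢
  -- It remains to treat `p`, which has the acyclic cofibration `s` as a section. The object `D` is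
  -- the cobase change of `s ≫ j₁` along `s`, so pushing `k` out along `p` returns `B₁`, as `s ≫ p`
  -- is the identity. The fold-like map `φ : D ⟶ B₁` is a weak equivalence under `Z`, and its cobase
  -- change along `p` is `g₂`.
  obtain ⟨D, k, l, hD, hk, -⟩ := hC.exists_pushout (s ≫ j₁) s (hC.cof_comp _ _ hs hj₁)
  have hl := hC.weq_of_isPushout hD.flip hs hs'
  let φ : D ⟶ B₁ := hD.desc j₁ (𝟙 _) (by simp)
  let ψ : D ⟶ B₁ := hD.desc (p ≫ s ≫ j₁) (𝟙 _) (by simp [reassoc_of% hsp])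
  have hφ : weq φ := hC.weq_of_precomp hl (by simpa [φ] using hC.weq_id B₁)
  have hψ : IsPushout p k (s ≫ j₁) ψ := by
    refine IsPushout.of_left (h₁₁ := s) (h₂₁ := l) (v₁₁ := s ≫ j₁) ?_ (by simp [ψ]) hD
    simpa [hsp, ψ] using IsPushout.id_horiz (s ≫ j₁)
  refine hC.weq_pushout_map_under hψ h₂ (g := φ) (by simp [φ]) ?_ ?_ hk hj₁ hφ
  · rw [Category.assoc, ← h₂.w, reassoc_of% hsp]
  · apply hD.hom_ext
    · simp [φ, ψ, ← h₂.w, reassoc_of% hsp]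
    · simp [φ, ψ]

/-- The gluing lemma. -/
theorem weq_pushout_map {A₁ B₁ C₁ P₁ A₂ B₂ C₂ P₂ : C}
    {f₁ : A₁ ⟶ C₁} {i₁ : A₁ ⟶ B₁} {j₁ : C₁ ⟶ P₁} {g₁ : B₁ ⟶ P₁}
    {f₂ : A₂ ⟶ C₂} {i₂ : A₂ ⟶ B₂} {j₂ : C₂ ⟶ P₂} {g₂ : B₂ ⟶ P₂}
    (h₁ : IsPushout f₁ i₁ j₁ g₁) (h₂ : IsPushout f₂ i₂ j₂ g₂)
    {a : A₁ ⟶ A₂} {b : B₁ ⟶ B₂} {c : C₁ ⟶ C₂} {p : P₁ ⟶ P₂}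
    (hf : f₁ ≫ c = a ≫ f₂) (hi : i₁ ≫ b = a ≫ i₂) (hj : j₁ ≫ p = c ≫ j₂)
    (hg : g₁ ≫ p = b ≫ g₂) (hi₁ : cof i₁) (hi₂ : cof i₂)
    (ha : weq a) (hb : weq b) (hc : weq c) : weq p := by
  have hj₁ := hC.cof_of_isPushout h₁ hi₁
  -- `P₁ ⟶ P₂` is split at `Q = P₁ ∪_{C₁} C₂`. The first half is a cobase change of `c`; the second
  -- is obtained from `B₁ ∪_{A₁} A₂ ⟶ B₂`, a weak equivalence under `A₂`, by pushing out along `f₂`.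
  obtain ⟨Q, k, e, hQ, -, -⟩ := hC.exists_pushout j₁ c hj₁
  have he := hC.weq_of_isPushout_cof hQ hj₁ hc
  obtain ⟨B', i', b', hB, hi', -⟩ := hC.exists_pushout i₁ a hi₁
  have hb' := hC.weq_of_isPushout_cof hB hi₁ ha
  let q : Q ⟶ P₂ := hQ.desc j₂ p hj.symm
  let b'' : B' ⟶ B₂ := hB.desc i₂ b hi.symm
  have hb'' : weq b'' := hC.weq_of_precomp hb' (by simpa [b''] using hb)
  have hQ' : IsPushout (a ≫ f₂) i₁ k (g₁ ≫ e) := hf ▸ h₁.paste_horiz hQ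
  have hQ'' := IsPushout.of_left' hQ' hB
  have : weq q := by
    refine hC.weq_pushout_map_under hQ'' h₂ (g := b'') (by simp [b'']) (by simp [q]) ?_ hi' hi₂ hb''
    apply hB.hom_ext
    · simp [q, b'', h₂.w]
    · simp [q, b'', hg]
  simpa [q] using hC.weq_comp he this

end

end IsCofibrationCategory

/-! ### Faces of simplices, and sieves as subcomplexes -/

namespace InjDelta

@[ext]
theorem hom_ext {m n : InjDelta} {f g : m ⟶ n}
    (h : ∀ x, (show Fin (m.len + 1) ↪o Fin (n.len + 1) from f) x =
      (show Fin (m.len + 1) ↪o Fin (n.len + 1) from g) x) : f = g :=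
  RelEmbedding.ext h

theorem len_le_of_hom {m n : InjDelta} (f : m ⟶ n) : m.len ≤ n.len := by
  have := Fintype.card_le_of_injective _
    (show Fin (m.len + 1) ↪o Fin (n.len + 1) from f).injective
  simpa using this

/-- An injective endomap of a finite set is bijective, and a finite chain has only one automorphism.
Thus every morphism of `Δ` either raises the dimension or is an identity, the dichotomy behind the
case distinctions below. -/
theorem endo_eq_id {m : InjDelta} (f : m ⟶ m) : f = 𝟙 m := by
  let g : Fin (m.len + 1) ↪o Fin (m.len + 1) := f
  have hg : Function.Surjective g := Finite.surjective_of_injective g.injective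
  have e : (RelIso.ofSurjective g hg : Fin (m.len + 1) ≃o Fin (m.len + 1)) = OrderIso.refl _ :=
    Subsingleton.elim _ _
  ext x
  exact congrArg (fun h : Fin (m.len + 1) ≃o Fin (m.len + 1) => (h x : ℕ)) e

theorem eq_of_len_eq {m n : InjDelta} (h : m.len = n.len) : m = n := by
  cases m; cases n; simpa using h

instance : Finite (Σ m : InjDelta, (m ⟶ n)) := by
  let φ : (Σ m : InjDelta, (m ⟶ n)) →
      Σ m : Fin (n.len + 1), (Fin (m.val + 1) ↪o Fin (n.len + 1)) :=
    fun x => ⟨⟨x.1.len, Nat.lt_succ_of_le (len_le_of_hom x.2)⟩, x.2⟩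
  refine Finite.of_injective φ ?_
  rintro ⟨⟨m⟩, f⟩ ⟨⟨m'⟩, f'⟩ h
  obtain rfl : m = m' := congrArg (fun x => x.1.val) h
  obtain rfl : f = f' := by simpa [φ] using h
  rfl

instance (n : InjDelta) : Finite (Sieve n) := by
  refine Finite.of_injective
    (fun K : Sieve n => {x : Σ m : InjDelta, (m ⟶ n) | K x.2}) fun K K' h => ?_
  ext m f
  exact Set.ext_iff.1 h ⟨m, f⟩

/-- The boundary of `Δ[n]`, as a sieve. -/
def boundary (n : InjDelta) : Sieve n where
  arrows m _ := m.len < n.len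
  downward_closed h f := lt_of_le_of_lt (len_le_of_hom f) h

/-- A face of a sieve is maximal dimensional if no face of the sieve has larger dimension. -/
def IsTopFace {m n : InjDelta} (K : Sieve n) (α : m ⟶ n) : Prop :=
  K α ∧ ∀ ⦃i⦄ (β : i ⟶ n), K β → i.len ≤ m.len

theorem exists_isTopFace {n : InjDelta} {K : Sieve n} (hK : K ≠ ⊥) :
    ∃ (m : InjDelta) (α : m ⟶ n), IsTopFace K α := by
  have hne : {x : Σ m : InjDelta, (m ⟶ n) | K x.2}.Nonempty := by
    by_contra h
    refine hK (le_bot_iff.1 fun m f hf => ?_)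
    exact (h ⟨⟨m, f⟩, hf⟩).elim
  obtain ⟨⟨m, α⟩, h, h'⟩ := Set.exists_max_image _ (fun x => x.1.len) (Set.toFinite _) hne
  exact ⟨m, α, h, fun i β hβ => h' ⟨i, β⟩ hβ⟩

/-- The sieve obtained by deleting a face of maximal dimension. -/
def eraseFace {m n : InjDelta} (K : Sieve n) (α : m ⟶ n) (hα : IsTopFace K α) : Sieve n where
  arrows i β := K β ∧ (⟨i, β⟩ : Σ i : InjDelta, (i ⟶ n)) ≠ ⟨m, α⟩
  downward_closed := by
    rintro i k β ⟨hβ, hne⟩ γ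
    refine ⟨K.downward_closed hβ γ, fun e => hne ?_⟩
    cases e
    obtain rfl := eq_of_len_eq (le_antisymm (hα.2 β hβ) (len_le_of_hom γ))
    rw [endo_eq_id γ, Category.id_comp]

theorem eraseFace_lt {m n : InjDelta} (K : Sieve n) (α : m ⟶ n) (hα : IsTopFace K α) :
    eraseFace K α hα < K :=
  lt_of_le_of_ne (fun _ _ h => h.1) fun e => (e.ge α hα.1).2 rfl

theorem eraseFace_comp {i m n : InjDelta} (K : Sieve n) (α : m ⟶ n) (hα : IsTopFace K α)
    (β : i ⟶ m) (h : i.len < m.len) : eraseFace K α hα (β ≫ α) :=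
  ⟨K.downward_closed hα.1 β, fun e => h.ne (congrArg (fun x => x.1.len) e)⟩

/-- Induction on the sieves on `[n]` by attaching faces. -/
theorem sieve_induction {n : InjDelta} {motive : Sieve n → Prop} (bot : motive ⊥)
    (attach : ∀ (K : Sieve n) ⦃m : InjDelta⦄ (α : m ⟶ n) (hα : IsTopFace K α),
      motive (eraseFace K α hα) → motive K) (K : Sieve n) : motive K := by
  induction K using WellFoundedLT.induction with
  | ind K ih =>
    by_cases h : K = ⊥
    · exact h ▸ bot
    · obtain ⟨m, α, hα⟩ := exists_isTopFace h
      exact attach K α hα (ih _ (eraseFace_lt K α hα))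

end InjDelta

open InjDelta

/-! ### Colimits over subcomplexes and latching objects -/

section Latching

variable {C : Type u} [Category.{v} C]

/-- `P` is the colimit of a co-`Δ`-object over the faces that belong to a sieve. -/
structure IsFaceColimit (A : CoDelta C) {n : InjDelta} (K : Sieve n) (P : C)
    (ι : ∀ ⦃i : InjDelta⦄ (α : i ⟶ n), K α → (A.obj i ⟶ P)) : Prop where
  w : ∀ ⦃i j : InjDelta⦄ (β : j ⟶ i) (α : i ⟶ n) (h : K α),
    A.map β ≫ ι α h = ι (β ≫ α) (K.downward_closed h β)
  exists_desc : ∀ ⦃X : C⦄ (x : ∀ ⦃i : InjDelta⦄ (α : i ⟶ n), K α → (A.obj i ⟶ X)),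
    (∀ ⦃i j : InjDelta⦄ (β : j ⟶ i) (α : i ⟶ n) (h : K α),
      A.map β ≫ x α h = x (β ≫ α) (K.downward_closed h β)) →
    ∃ d : P ⟶ X, ∀ ⦃i : InjDelta⦄ (α : i ⟶ n) (h : K α), ι α h ≫ d = x α h
  hom_ext : ∀ ⦃X : C⦄ (d d' : P ⟶ X),
    (∀ ⦃i : InjDelta⦄ (α : i ⟶ n) (h : K α), ι α h ≫ d = ι α h ≫ d') → d = d'

/-- The universal morphism of a latching object that belongs to a proper face. -/
def LatchingObject.ι {A : CoDelta C} {n : InjDelta} (L : LatchingObject A n) {i : InjDelta}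
    (α : i ⟶ n) (h : i.len < n.len) : A.obj i ⟶ L.cocone.pt :=
  L.cocone.ι.app (⟨Over.mk α, h⟩ : BoundaryIndex n)

namespace LatchingObject

variable {A B : CoDelta C} {n : InjDelta}

theorem map_ι (L : LatchingObject A n) {i j : InjDelta} (β : j ⟶ i) (α : i ⟶ n)
    (h : i.len < n.len) :
    A.map β ≫ L.ι α h = L.ι (β ≫ α) (lt_of_le_of_lt (len_le_of_hom β) h) :=
  L.cocone.w (j' := (⟨Over.mk (β ≫ α), lt_of_le_of_lt (len_le_of_hom β) h⟩ : BoundaryIndex n))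
    (j := ⟨Over.mk α, h⟩)
    (ObjectProperty.homMk (Over.homMk (U := Over.mk (β ≫ α)) (V := Over.mk α) β rfl))

theorem map_ι_assoc (L : LatchingObject A n) {i j : InjDelta} (β : j ⟶ i) (α : i ⟶ n)
    (h : i.len < n.len) {X : C} (x : L.cocone.pt ⟶ X) :
    A.map β ≫ L.ι α h ≫ x = L.ι (β ≫ α) (lt_of_le_of_lt (len_le_of_hom β) h) ≫ x := by
  rw [← map_ι L β α h, Category.assoc]

theorem hom_ext (L : LatchingObject A n) {X : C} {d d' : L.cocone.pt ⟶ X}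
    (h : ∀ ⦃i : InjDelta⦄ (α : i ⟶ n) (h : i.len < n.len), L.ι α h ≫ d = L.ι α h ≫ d') :
    d = d' :=
  L.isColimit.hom_ext fun β => h β.obj.hom β.property

@[simp]
theorem ι_latchingMap (L : LatchingObject A n) {i : InjDelta} (α : i ⟶ n) (h : i.len < n.len) :
    L.ι α h ≫ latchingMap L = A.map α :=
  _root_.ι_latchingMap L _

@[simp]
theorem ι_latchingMap_assoc (L : LatchingObject A n) {i : InjDelta} (α : i ⟶ n)
    (h : i.len < n.len) {X : C} (x : A.obj n ⟶ X) :
    L.ι α h ≫ latchingMap L ≫ x = A.map α ≫ x := by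
  rw [← ι_latchingMap L α h, Category.assoc]

@[simp]
theorem ι_latchingObjectMap (f : A ⟶ B) (L : LatchingObject A n) (M : LatchingObject B n)
    {i : InjDelta} (α : i ⟶ n) (h : i.len < n.len) :
    L.ι α h ≫ latchingObjectMap f L M = f.app i ≫ M.ι α h :=
  _root_.ι_latchingObjectMap f L M _

@[simp]
theorem ι_latchingObjectMap_assoc (f : A ⟶ B) (L : LatchingObject A n) (M : LatchingObject B n)
    {i : InjDelta} (α : i ⟶ n) (h : i.len < n.len) {X : C} (x : M.cocone.pt ⟶ X) :
    L.ι α h ≫ latchingObjectMap f L M ≫ x = f.app i ≫ M.ι α h ≫ x := by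
  rw [← Category.assoc, ι_latchingObjectMap, Category.assoc]

/-- The cocone on the latching diagram given by a compatible family of morphisms. -/
@[simps]
def coconeMk {X : C} (x : ∀ ⦃i : InjDelta⦄ (_ : i ⟶ n), i.len < n.len → (A.obj i ⟶ X))
    (hx : ∀ ⦃i j : InjDelta⦄ (β : j ⟶ i) (α : i ⟶ n) (h : i.len < n.len),
      A.map β ≫ x α h = x (β ≫ α) (lt_of_le_of_lt (len_le_of_hom β) h)) :
    Cocone (latchingDiagram A n) where
  pt := X
  ι :=
    { app := fun γ => x γ.obj.hom γ.property
      naturality := fun _ β f => by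
        have := hx f.hom.left β.obj.hom β.property
        simp only [Over.w] at this
        simpa using this }

theorem exists_desc (L : LatchingObject A n) {X : C}
    (x : ∀ ⦃i : InjDelta⦄ (_ : i ⟶ n), i.len < n.len → (A.obj i ⟶ X))
    (hx : ∀ ⦃i j : InjDelta⦄ (β : j ⟶ i) (α : i ⟶ n) (h : i.len < n.len),
      A.map β ≫ x α h = x (β ≫ α) (lt_of_le_of_lt (len_le_of_hom β) h)) :
    ∃ d : L.cocone.pt ⟶ X, ∀ ⦃i : InjDelta⦄ (α : i ⟶ n) (h : i.len < n.len), L.ι α h ≫ d = x α h :=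
  ⟨L.isColimit.desc (coconeMk x hx), fun _ _ _ => L.isColimit.fac (coconeMk x hx) _⟩

end LatchingObject

namespace IsFaceColimit

variable {A : CoDelta C} {n : InjDelta}

/-- The latching object given by a colimit over the boundary. -/
noncomputable def latchingObject {P : C}
    {ι : ∀ ⦃i : InjDelta⦄ (α : i ⟶ n), boundary n α → (A.obj i ⟶ P)}
    (h : IsFaceColimit A (boundary n) P ι) : LatchingObject A n :=
  have hd (s : Cocone (latchingDiagram A n)) := h.exists_desc (X := s.pt)
    (fun _ α hi => s.ι.app (⟨Over.mk α, hi⟩ : BoundaryIndex n))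
    (fun _ _ β α hi => s.w (j' := (⟨Over.mk (β ≫ α), lt_of_le_of_lt (len_le_of_hom β) hi⟩ :
      BoundaryIndex n)) (j := ⟨Over.mk α, hi⟩)
        (ObjectProperty.homMk (Over.homMk (U := Over.mk (β ≫ α)) (V := Over.mk α) β rfl)))
  ⟨LatchingObject.coconeMk ι h.w,
    { desc := fun s => (hd s).choose
      fac := fun s _ => (hd s).choose_spec _ _
      uniq := fun s _ hm => h.hom_ext _ _ fun _ α hi =>
        (hm (⟨Over.mk α, hi⟩ : BoundaryIndex n)).trans ((hd s).choose_spec _ _).symm }⟩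

theorem bot {P : C} (hP : IsInitial P) :
    IsFaceColimit A (⊥ : Sieve n) P (fun _ _ h => h.elim) where
  w _ _ _ _ h := h.elim
  exists_desc X _ _ := ⟨hP.to X, fun _ _ h => h.elim⟩
  hom_ext _ _ _ _ := hP.hom_ext _ _

/-- Attaching a face of maximal dimension is a cobase change of a latching map. -/
theorem attach {K : Sieve n} {m : InjDelta} {α : m ⟶ n} {hα : IsTopFace K α} {P : C}
    {ι : ∀ ⦃i : InjDelta⦄ (β : i ⟶ n), eraseFace K α hα β → (A.obj i ⟶ P)}
    (hP : IsFaceColimit A (eraseFace K α hα) P ι) (L : LatchingObject A m)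
    {b : L.cocone.pt ⟶ P} (hb : ∀ ⦃i : InjDelta⦄ (β : i ⟶ m) (h : i.len < m.len),
      L.ι β h ≫ b = ι (β ≫ α) (eraseFace_comp K α hα β h))
    {P' : C} {j : P ⟶ P'} {g : A.obj m ⟶ P'} (hP' : IsPushout b (latchingMap L) j g) :
    ∃ κ : ∀ ⦃i : InjDelta⦄ (β : i ⟶ n), K β → (A.obj i ⟶ P'),
      IsFaceColimit A K P' κ ∧ κ α hα.1 = g ∧
        ∀ ⦃i : InjDelta⦄ (β : i ⟶ n) (h : eraseFace K α hα β), κ β h.1 = ι β h ≫ j := by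
  classical
  -- The faces of `K` are those already present and `α` itself; the `eqToHom` only transports along
  -- the equality of faces.
  let κ : ∀ ⦃i : InjDelta⦄ (β : i ⟶ n), K β → (A.obj i ⟶ P') := fun i β h =>
    if e : (⟨i, β⟩ : Σ i : InjDelta, (i ⟶ n)) = ⟨m, α⟩ then
      eqToHom (by cases e; rfl) ≫ g else ι β ⟨h, e⟩ ≫ j
  have hκ : κ α hα.1 = g := by simp [κ]
  have hκ' : ∀ ⦃i : InjDelta⦄ (β : i ⟶ n) (h : eraseFace K α hα β), κ β h.1 = ι β h ≫ j :=
    fun i β h => dif_neg h.2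
  refine ⟨κ, ⟨fun i k γ β h => ?_, fun X x hx => ?_, fun X d d' h => ?_⟩, hκ, hκ'⟩
  · by_cases e : (⟨i, β⟩ : Σ i : InjDelta, (i ⟶ n)) = ⟨m, α⟩
    -- A proper face of `α` is compatible because the pushout glues it along the latching object;
    -- the only other morphism into `α` is the identity.
    · cases e
      by_cases hk : k.len < m.len
      · rw [hκ, hκ' _ (eraseFace_comp K α hα γ hk), ← hb γ hk, Category.assoc, hP'.w,
          LatchingObject.ι_latchingMap_assoc]
      · obtain rfl := eq_of_len_eq (le_antisymm (len_le_of_hom γ) (not_lt.1 hk))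
        obtain rfl := endo_eq_id γ
        simp
    · have h' : eraseFace K α hα β := ⟨h, e⟩
      rw [hκ' β h', ← Category.assoc, hP.w γ β h',
        hκ' (γ ≫ β) ((eraseFace K α hα).downward_closed h' γ)]
  · obtain ⟨d, hd⟩ := hP.exists_desc (fun i β h => x β h.1) fun i k γ β h => hx γ β h.1
    have w : b ≫ d = latchingMap L ≫ x α hα.1 := L.hom_ext fun i β h => by
      rw [← Category.assoc, hb, hd, LatchingObject.ι_latchingMap_assoc, hx]
    refine ⟨hP'.desc d (x α hα.1) w, fun i β h => ?_⟩
    by_cases e : (⟨i, β⟩ : Σ i : InjDelta, (i ⟶ n)) = ⟨m, α⟩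
    · cases e
      rw [hκ, hP'.inr_desc]
    · have h' : eraseFace K α hα β := ⟨h, e⟩
      rw [hκ' β h', Category.assoc, hP'.inl_desc, hd β h']
  · refine hP'.hom_ext (hP.hom_ext _ _ fun i β hβ => ?_) ?_
    · rw [← Category.assoc, ← Category.assoc, ← hκ' β hβ, h β hβ.1]
    · rw [← hκ, h α hα.1]

end IsFaceColimit

/-- A co-`Δ`-object is cofibrant in dimension `n`. -/
def CofibrantAt (cof : MorphismProperty C) (A : CoDelta C) (n : InjDelta) : Prop :=
  ∃ L : LatchingObject A n, cof (latchingMap L)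

/-- A morphism of co-`Δ`-objects is a cofibration in dimension `n`. -/
def CofibrationAt (cof : MorphismProperty C) {A B : CoDelta C} (f : A ⟶ B) (n : InjDelta) : Prop :=
  ∃ (L : LatchingObject A n) (M : LatchingObject B n) (P : C)
    (inl : A.obj n ⟶ P) (inr : M.cocone.pt ⟶ P)
    (h : IsPushout (latchingMap L) (latchingObjectMap f L M) inl inr),
    cof (h.desc (f.app n) (latchingMap M) (latchingMap_naturality f L M))

namespace LatchingObject

variable {A B D : CoDelta C} {n : InjDelta}

/-- The latching objects of co-`Δ`-objects that are isomorphic below dimension `n`. -/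
noncomputable def ofIsIso (g : A ⟶ B) (hg : ∀ i : InjDelta, i.len < n.len → IsIso (g.app i))
    (M : LatchingObject B n) : LatchingObject A n :=
  IsFaceColimit.latchingObject (P := M.cocone.pt) (ι := fun i α h => g.app i ≫ M.ι α h)
    { w := fun _ j β α h => (g.naturality_assoc β _).trans (congrArg (g.app j ≫ ·) (M.map_ι β α h))
      exists_desc := fun X x hx => by
        obtain ⟨d, hd⟩ := M.exists_desc
          (fun i α h => have := hg i h; inv (g.app i) ≫ x α h) (fun i j β α h => by
            have := hg i h
            have := hg j (lt_of_le_of_lt (len_le_of_hom β) h)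
            rw [← hx β α h, IsIso.eq_inv_comp, ← g.naturality_assoc, IsIso.hom_inv_id_assoc])
        refine ⟨d, fun i α h => ?_⟩
        have := hg i h
        rw [Category.assoc, hd α h, IsIso.hom_inv_id_assoc]
      hom_ext := fun X d d' h => M.hom_ext fun i α hi => by
        have := hg i hi
        rw [← cancel_epi (g.app i)]
        simpa using h α hi }

theorem latchingObjectMap_comp (f : A ⟶ B) (g : B ⟶ D) (L : LatchingObject A n)
    (M : LatchingObject B n) (N : LatchingObject D n) :
    latchingObjectMap (f ≫ g) L N = latchingObjectMap f L M ≫ latchingObjectMap g M N :=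
  L.hom_ext fun i α h => by simp

theorem isIso_latchingObjectMap (g : A ⟶ B)
    (hg : ∀ i : InjDelta, i.len < n.len → IsIso (g.app i)) (L : LatchingObject A n)
    (M : LatchingObject B n) : IsIso (latchingObjectMap g L M) := by
  obtain ⟨d, hd⟩ := M.exists_desc
    (fun i α h => have := hg i h; inv (g.app i) ≫ L.ι α h) (fun i j β α h => by
      have := hg i h
      have := hg j (lt_of_le_of_lt (len_le_of_hom β) h)
      rw [← map_ι L β α h, IsIso.eq_inv_comp, ← g.naturality_assoc, IsIso.hom_inv_id_assoc])
  refine ⟨d, L.hom_ext fun i α h => ?_, M.hom_ext fun i α h => ?_⟩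
  · have := hg i h
    rw [ι_latchingObjectMap_assoc, hd, IsIso.hom_inv_id_assoc, Category.comp_id]
  · have := hg i h
    rw [← Category.assoc, hd, Category.assoc, ι_latchingObjectMap, IsIso.inv_hom_id_assoc,
      Category.comp_id]

end LatchingObject

/-! ### Cofibrations of co-`Δ`-objects, one dimension at a time -/

open LatchingObject

theorem CofibrationAt.mk' {cof : MorphismProperty C} {A B : CoDelta C} {f : A ⟶ B} {n : InjDelta}
    {L : LatchingObject A n} {M : LatchingObject B n} {P : C}
    {inl : A.obj n ⟶ P} {inr : M.cocone.pt ⟶ P}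
    (h : IsPushout (latchingMap L) (latchingObjectMap f L M) inl inr) {r : P ⟶ B.obj n}
    (hl : inl ≫ r = f.app n) (hr : inr ≫ r = latchingMap M) (hcof : cof r) :
    CofibrationAt cof f n := by
  refine ⟨L, M, P, inl, inr, h, ?_⟩
  convert hcof
  exact h.hom_ext (by simp [hl]) (by simp [hr])

namespace IsCofibrationCategory

variable {cof weq : MorphismProperty C} (hC : IsCofibrationCategory cof weq)
  {A B : CoDelta C} {n : InjDelta}
include hC

theorem cof_iso_comp {X Y Z : C} (e : X ⟶ Y) [IsIso e] {f : Y ⟶ Z} (hf : cof f) : cof (e ≫ f) :=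
  hC.cof_comp _ _ (hC.cof_of_isIso _ inferInstance) hf

theorem cof_comp_iso {X Y Z : C} {f : X ⟶ Y} (e : Y ⟶ Z) [IsIso e] (hf : cof f) : cof (f ≫ e) :=
  hC.cof_comp _ _ hf (hC.cof_of_isIso _ inferInstance)

theorem cof_of_comp_iso {X Y Z : C} {f : X ⟶ Y} (e : Y ⟶ Z) [IsIso e] (hf : cof (f ≫ e)) :
    cof f := by
  simpa using hC.cof_comp_iso (inv e) hf

theorem cof_latchingMap (h : CofibrantAt cof A n) (L : LatchingObject A n) :
    cof (latchingMap L) := by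
  obtain ⟨L', h'⟩ := h
  have := isIso_latchingObjectMap (𝟙 A) (fun _ _ => inferInstance) L L'
  have e := latchingMap_naturality (𝟙 A) L L'
  rw [NatTrans.id_app, Category.comp_id] at e
  exact e ▸ hC.cof_iso_comp _ h'

/-- The characterization of cofibrations in dimension `n` does not depend on choices, and it depends
on the target only up to dimension `n`. -/
theorem cof_of_cofibrationAt_comp {D : CoDelta C} {f : A ⟶ B} {g : B ⟶ D}
    (hg : ∀ i : InjDelta, i.len ≤ n.len → IsIso (g.app i)) (h : CofibrationAt cof (f ≫ g) n)
    {L : LatchingObject A n} {M : LatchingObject B n} {P : C}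
    {inl : A.obj n ⟶ P} {inr : M.cocone.pt ⟶ P}
    (hP : IsPushout (latchingMap L) (latchingObjectMap f L M) inl inr) {r : P ⟶ B.obj n}
    (hl : inl ≫ r = f.app n) (hr : inr ≫ r = latchingMap M) : cof r := by
  obtain ⟨L', M', P', inl', inr', hP', h'⟩ := h
  have := isIso_latchingObjectMap (𝟙 A) (fun _ _ => inferInstance) L L'
  have := isIso_latchingObjectMap g (fun i hi => hg i hi.le) M M'
  have := hg n le_rfl
  have e : latchingObjectMap f L M ≫ latchingObjectMap g M M' =
      latchingObjectMap (𝟙 A) L L' ≫ latchingObjectMap (f ≫ g) L' M' := by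
    rw [← latchingObjectMap_comp, ← latchingObjectMap_comp, Category.id_comp]
  have e₂ : latchingObjectMap (𝟙 A) L L' ≫ latchingObjectMap (f ≫ g) L' M' ≫
      inv (latchingObjectMap g M M') = latchingObjectMap f L M := by
    rw [← Category.assoc, ← e, Category.assoc, IsIso.hom_inv_id, Category.comp_id]
  have e' := latchingMap_naturality (𝟙 A) L L'
  rw [NatTrans.id_app, Category.comp_id] at e'
  have hP'' : IsPushout (latchingMap L) (latchingObjectMap f L M) inl'
      (latchingObjectMap g M M' ≫ inr') := by
    refine IsPushout.of_iso hP' (asIso (latchingObjectMap (𝟙 A) L L')).symm (Iso.refl _)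
      (asIso (latchingObjectMap g M M')).symm (Iso.refl _) ?_ ?_ ?_ ?_
    · simp [e']
    · simp [e₂]
    · simp
    · simp
  refine hC.cof_of_comp_iso (g.app n) ?_
  have : r ≫ g.app n = (hP.isoIsPushout _ _ hP'').hom ≫ hP'.desc ((f ≫ g).app n) (latchingMap M')
      (latchingMap_naturality (f ≫ g) L' M') := by
    apply hP.hom_ext
    · simp [reassoc_of% hl]
    · rw [reassoc_of% hr, latchingMap_naturality g M M']
      simp
  rw [this]
  exact hC.cof_iso_comp _ h'

theorem cof_of_cofibrationAt {f : A ⟶ B} (h : CofibrationAt cof f n)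
    {L : LatchingObject A n} {M : LatchingObject B n} {P : C}
    {inl : A.obj n ⟶ P} {inr : M.cocone.pt ⟶ P}
    (hP : IsPushout (latchingMap L) (latchingObjectMap f L M) inl inr) {r : P ⟶ B.obj n}
    (hl : inl ≫ r = f.app n) (hr : inr ≫ r = latchingMap M) : cof r :=
  hC.cof_of_cofibrationAt_comp (g := 𝟙 B) (fun _ _ => inferInstance)
    (by rwa [Category.comp_id]) hP hl hr

/-- Being a cofibration in dimension `n` sees the target only up to that dimension. This carries the
property between stages of a tower, and to its limit, that agree in low dimensions. -/
theorem cofibrationAt_of_comp {D : CoDelta C} {f : A ⟶ B} {g : B ⟶ D}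
    (hg : ∀ i : InjDelta, i.len ≤ n.len → IsIso (g.app i)) (hA : CofibrantAt cof A n)
    (h : CofibrationAt cof (f ≫ g) n) : CofibrationAt cof f n := by
  have ⟨L, M', _⟩ := h
  let M := M'.ofIsIso g (fun i hi => hg i hi.le)
  obtain ⟨P, inr, inl, hP, -, -⟩ :=
    hC.exists_pushout (latchingMap L) (latchingObjectMap f L M) (hC.cof_latchingMap hA L)
  exact ⟨L, M, P, inl, inr, hP.flip,
    hC.cof_of_cofibrationAt_comp hg h hP.flip (by simp) (by simp)⟩

/-- The latching map of `B` is a cobase change of that of `A`, followed by the relative latching map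
of `f`. -/
theorem cofibrantAt_of_cofibrationAt {f : A ⟶ B} (hA : CofibrantAt cof A n)
    (hf : CofibrationAt cof f n) : CofibrantAt cof B n := by
  obtain ⟨L, M, P, inl, inr, h, hcof⟩ := hf
  refine ⟨M, ?_⟩
  have := hC.cof_comp _ _ (hC.cof_of_isPushout h.flip (hC.cof_latchingMap hA L)) hcof
  simpa using this

theorem exists_isFaceColimit (K : Sieve n)
    (hA : ∀ ⦃m : InjDelta⦄ (α : m ⟶ n), K α → CofibrantAt cof A m) :
    ∃ (P : C) (ι : ∀ ⦃i : InjDelta⦄ (α : i ⟶ n), K α → (A.obj i ⟶ P)), IsFaceColimit A K P ι := by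
  induction K using sieve_induction with
  | bot =>
    have := hC.hasInitial
    exact ⟨_, _, IsFaceColimit.bot initialIsInitial⟩
  | attach K α hα ih =>
    obtain ⟨P, ι, h⟩ := ih fun m β hβ => hA β hβ.1
    obtain ⟨L, hL⟩ := hA α hα.1
    obtain ⟨b, hb⟩ := L.exists_desc (fun i β hi => ι (β ≫ α) (eraseFace_comp K α hα β hi))
      (fun i j γ β hi => by simp [h.w])
    obtain ⟨P', j, g, hP', -⟩ := hC.exists_pushout (latchingMap L) b hL
    obtain ⟨κ, hκ, -⟩ := h.attach L hb hP'
    exact ⟨P', κ, hκ⟩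

theorem nonempty_latchingObject (hA : ∀ m : InjDelta, m.len < n.len → CofibrantAt cof A m) :
    Nonempty (LatchingObject A n) := by
  obtain ⟨P, ι, h⟩ := hC.exists_isFaceColimit (boundary n) (fun m _ hm => hA m hm)
  exact ⟨h.latchingObject⟩

/-- Attaching a face changes both colimits by pushouts along latching maps. The relative latching
map of `f` at that face is exactly the relative cofibration needed by `cof_pushout_map`. Both
colimits are built in one induction so that the comparison map is controlled throughout. -/
theorem exists_cof_isFaceColimit (f : A ⟶ B) (K : Sieve n)
    (hA : ∀ ⦃m : InjDelta⦄ (α : m ⟶ n), K α → CofibrantAt cof A m)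
    (hf : ∀ ⦃m : InjDelta⦄ (α : m ⟶ n), K α → CofibrationAt cof f m) :
    ∃ (P : C) (ι : ∀ ⦃i : InjDelta⦄ (α : i ⟶ n), K α → (A.obj i ⟶ P)) (Q : C)
      (κ : ∀ ⦃i : InjDelta⦄ (α : i ⟶ n), K α → (B.obj i ⟶ Q)) (d : P ⟶ Q),
      IsFaceColimit A K P ι ∧ IsFaceColimit B K Q κ ∧
        (∀ ⦃i : InjDelta⦄ (α : i ⟶ n) (h : K α), ι α h ≫ d = f.app i ≫ κ α h) ∧ cof d := by
  induction K using sieve_induction with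
  | bot =>
    have := hC.hasInitial
    exact ⟨_, _, _, _, 𝟙 _, IsFaceColimit.bot initialIsInitial, IsFaceColimit.bot initialIsInitial,
      fun _ _ h => h.elim, hC.cof_of_isIso _ inferInstance⟩
  | attach K α hα ih =>
    rename_i m
    obtain ⟨P, ι, Q, κ, d, hP, hQ, hd, hcof⟩ := ih (fun m β hβ => hA β hβ.1) fun m β hβ => hf β hβ.1
    obtain ⟨L, M, R, inl, inr, hR, hr⟩ := hf α hα.1
    obtain ⟨b, hb⟩ := L.exists_desc (fun i β hi => ι (β ≫ α) (eraseFace_comp K α hα β hi))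
      (fun i j γ β hi => by simp [hP.w])
    obtain ⟨c, hc⟩ := M.exists_desc (fun i β hi => κ (β ≫ α) (eraseFace_comp K α hα β hi))
      (fun i j γ β hi => by simp [hQ.w])
    obtain ⟨P', j, g, hP', -⟩ := hC.exists_pushout (latchingMap L) b
      (hC.cof_latchingMap (hA α hα.1) L)
    obtain ⟨Q', k, l, hQ', -⟩ := hC.exists_pushout (latchingMap M) c
      (hC.cof_latchingMap (hC.cofibrantAt_of_cofibrationAt (hA α hα.1) (hf α hα.1)) M)
    obtain ⟨ι', hι, hι₁, hι₂⟩ := hP.attach L hb hP'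
    obtain ⟨κ', hκ, hκ₁, hκ₂⟩ := hQ.attach M hc hQ'
    have w : b ≫ d = latchingObjectMap f L M ≫ c := L.hom_ext fun i β hi => by
      rw [← Category.assoc, hb, hd, ι_latchingObjectMap_assoc, hc]
    have w' : b ≫ d ≫ k = latchingMap L ≫ f.app m ≫ l := by
      rw [← Category.assoc, w, Category.assoc, hQ'.w, ← Category.assoc, ← latchingMap_naturality,
        Category.assoc]
    refine ⟨P', ι', Q', κ', hP'.desc (d ≫ k) (f.app m ≫ l) w', hι, hκ, fun i β h => ?_, ?_⟩
    · by_cases e : (⟨i, β⟩ : Σ i : InjDelta, (i ⟶ n)) = ⟨m, α⟩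
      · cases e
        rw [hι₁, hκ₁, hP'.inr_desc]
      · have h' : eraseFace K α hα β := ⟨h, e⟩
        rw [hι₂ β h', hκ₂ β h', Category.assoc, hP'.inl_desc, ← Category.assoc, hd,
          Category.assoc]
    · exact hC.cof_pushout_map hP' hQ' hR (hR.inl_desc _ _ _) (hR.inr_desc _ _ _) w
        (by simp) (by simp) hcof hr

theorem cof_latchingObjectMap (f : A ⟶ B)
    (hA : ∀ m : InjDelta, m.len < n.len → CofibrantAt cof A m)
    (hf : ∀ m : InjDelta, m.len < n.len → CofibrationAt cof f m)
    (L : LatchingObject A n) (M : LatchingObject B n) : cof (latchingObjectMap f L M) := by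
  obtain ⟨P, ι, Q, κ, d, hP, hQ, hd, hcof⟩ := hC.exists_cof_isFaceColimit f (boundary n)
    (fun m _ hm => hA m hm) (fun m _ hm => hf m hm)
  have e : latchingObjectMap f hP.latchingObject hQ.latchingObject = d :=
    LatchingObject.hom_ext _ fun i α h => (ι_latchingObjectMap _ _ _ _ _).trans (hd α h).symm
  have := isIso_latchingObjectMap (𝟙 A) (fun _ _ => inferInstance) L hP.latchingObject
  have := isIso_latchingObjectMap (𝟙 B) (fun _ _ => inferInstance) M hQ.latchingObject
  refine hC.cof_of_comp_iso (latchingObjectMap (𝟙 B) M hQ.latchingObject) ?_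
  rw [← latchingObjectMap_comp, Category.comp_id, ← Category.id_comp f,
    latchingObjectMap_comp _ _ _ hP.latchingObject, e]
  exact hC.cof_iso_comp _ hcof

/-- `fⁿ` is a cobase change of `∂ⁿf` followed by the relative latching map. -/
theorem cof_app (f : A ⟶ B) (hA : IsCofibrantCoDelta cof A) (hf : coDeltaCofibrations cof f)
    (n : InjDelta) : cof (f.app n) := by
  obtain ⟨L, M, P, inl, inr, h, hcof⟩ := hf n
  have := hC.cof_comp _ _ (hC.cof_of_isPushout h
    (hC.cof_latchingObjectMap f (fun m _ => hA m) (fun m _ => hf m) L M)) hcof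
  simpa using this

end IsCofibrationCategory

/-! ### Factorization of morphisms of co-`Δ`-objects -/

open Classical in
/-- The co-`Δ`-object with prescribed values `Y m`, given maps `t m` to a co-`Δ`-object `X` and
lifts along `t` of the structure morphisms of `X` other than the identities. -/
noncomputable def CoDelta.lift (X : CoDelta C) (Y : InjDelta → C) (t : ∀ m, Y m ⟶ X.obj m)
    (l : ∀ ⦃k m : InjDelta⦄ (_ : k ⟶ m), k.len < m.len → (X.obj k ⟶ Y m))
    (hl : ∀ ⦃k m : InjDelta⦄ (α : k ⟶ m) (h : k.len < m.len), l α h ≫ t m = X.map α)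
    (hl' : ∀ ⦃i k m : InjDelta⦄ (α : i ⟶ k) (β : k ⟶ m) (h : k.len < m.len),
      X.map α ≫ l β h = l (α ≫ β) (lt_of_le_of_lt (len_le_of_hom α) h)) : CoDelta C where
  obj := Y
  map {k m} α := if h : k.len < m.len then t k ≫ l α h else
    eqToHom (by rw [eq_of_len_eq (le_antisymm (len_le_of_hom α) (not_lt.1 h))])
  map_id m := by simp
  map_comp {i k m} α β := by
    have h₁ := len_le_of_hom α
    have h₂ := len_le_of_hom β
    by_cases hα : i.len < k.len
    · rw [dif_pos hα, dif_pos (hα.trans_le h₂)]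
      by_cases hβ : k.len < m.len
      · rw [dif_pos hβ, Category.assoc, reassoc_of% hl α hα, hl' α β hβ]
      · obtain rfl := eq_of_len_eq (le_antisymm h₂ (not_lt.1 hβ))
        obtain rfl := endo_eq_id β
        simp
    · obtain rfl := eq_of_len_eq (le_antisymm h₁ (not_lt.1 hα))
      obtain rfl := endo_eq_id α
      simp

/-- Seals off the case distinction in `CoDelta.lift`: only the values and the structure morphisms
that raise dimension are needed afterwards. -/
theorem CoDelta.exists_lift (X : CoDelta C) (Y : InjDelta → C) (t : ∀ m, Y m ⟶ X.obj m)
    (l : ∀ ⦃k m : InjDelta⦄ (_ : k ⟶ m), k.len < m.len → (X.obj k ⟶ Y m))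
    (hl : ∀ ⦃k m : InjDelta⦄ (α : k ⟶ m) (h : k.len < m.len), l α h ≫ t m = X.map α)
    (hl' : ∀ ⦃i k m : InjDelta⦄ (α : i ⟶ k) (β : k ⟶ m) (h : k.len < m.len),
      X.map α ≫ l β h = l (α ≫ β) (lt_of_le_of_lt (len_le_of_hom α) h)) :
    ∃ (X' : CoDelta C) (e : X'.obj = Y), ∀ ⦃k m : InjDelta⦄ (α : k ⟶ m) (h : k.len < m.len),
      X'.map α ≫ eqToHom (congrFun e m) = eqToHom (congrFun e k) ≫ t k ≫ l α h :=
  ⟨CoDelta.lift X Y t l hl hl', rfl, fun _ _ _ h =>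
    (Category.comp_id _).trans ((dif_pos h).trans (Category.id_comp _).symm)⟩

namespace IsCofibrationCategory

variable {cof weq : MorphismProperty C} (hC : IsCofibrationCategory cof weq)
include hC

/-- A morphism from a cofibrant co-`Δ`-object which is a cofibration below dimension `n` becomes a
cofibration in dimension `n` after replacing the target in dimension `n`. -/
theorem exists_factorization_step {A X : CoDelta C} (hA : IsCofibrantCoDelta cof A) (a : A ⟶ X)
    (n : ℕ) (ha : ∀ m : InjDelta, m.len < n → CofibrationAt cof a m) :
    ∃ (X' : CoDelta C) (a' : A ⟶ X') (t : X' ⟶ X), a' ≫ t = a ∧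
      (∀ m : InjDelta, m.len ≠ n → IsIso (t.app m)) ∧ levelEquivalences weq t ∧
      ∀ m : InjDelta, m.len < n + 1 → CofibrationAt cof a' m := by
  have key (m : InjDelta) : ∃ (Y : C) (t : Y ⟶ X.obj m) (a' : A.obj m ⟶ Y)
      (l : ∀ ⦃k : InjDelta⦄ (_ : k ⟶ m), k.len < m.len → (X.obj k ⟶ Y)),
      (∀ ⦃k : InjDelta⦄ (α : k ⟶ m) (h : k.len < m.len), l α h ≫ t = X.map α) ∧
      (∀ ⦃i k : InjDelta⦄ (α : i ⟶ k) (β : k ⟶ m) (h : k.len < m.len),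
        X.map α ≫ l β h = l (α ≫ β) (lt_of_le_of_lt (len_le_of_hom α) h)) ∧
      a' ≫ t = a.app m ∧
      (∀ ⦃k : InjDelta⦄ (α : k ⟶ m) (h : k.len < m.len), A.map α ≫ a' = a.app k ≫ l α h) ∧
      (m.len ≠ n → IsIso t) ∧ weq t ∧
      (m.len = n → ∃ (L : LatchingObject A m) (M : LatchingObject X m) (P : C)
        (inl : A.obj m ⟶ P) (inr : M.cocone.pt ⟶ P)
        (_ : IsPushout (latchingMap L) (latchingObjectMap a L M) inl inr) (c : P ⟶ Y),
        cof c ∧ inl ≫ c = a' ∧ ∀ ⦃k : InjDelta⦄ (α : k ⟶ m) (h : k.len < m.len),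
          M.ι α h ≫ inr ≫ c = l α h) := by
    by_cases hm : m.len = n
    · subst hm
      obtain ⟨L, hL⟩ := hA m
      obtain ⟨M⟩ := hC.nonempty_latchingObject (A := X) (n := m)
        fun i hi => hC.cofibrantAt_of_cofibrationAt (hA i) (ha i hi)
      obtain ⟨P, inr, inl, hP, -, -⟩ := hC.exists_pushout _ (latchingObjectMap a L M) hL
      -- The new value in dimension `n` factors the relative latching map `A ∪ ∂X ⟶ X` as a
      -- cofibration followed by a weak equivalence; all other values stay those of `X`.
      obtain ⟨Y, c, t, hc, ht, e⟩ := hC.exists_factorization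
        (hP.flip.desc (a.app m) (latchingMap M) (latchingMap_naturality a L M))
      refine ⟨Y, t, inl ≫ c, fun k α h => M.ι α h ≫ inr ≫ c, ?_, ?_, ?_, ?_, ?_, ht, ?_⟩
      · intro k α h
        simp [e]
      · intro i k α β h
        rw [M.map_ι_assoc]
      · simp [e]
      · intro k α h
        rw [← L.ι_latchingMap_assoc α h, hP.flip.w_assoc, ι_latchingObjectMap_assoc]
      · exact fun h => (h rfl).elim
      · exact fun _ => ⟨L, M, P, inl, inr, hP.flip, c, hc, rfl, fun _ _ _ => rfl⟩
    · exact ⟨X.obj m, 𝟙 _, a.app m, fun k α _ => X.map α, by simp, by simp, by simp, by simp,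
        fun _ => inferInstance, hC.weq_id _, fun h => (hm h).elim⟩
  choose Y t a' l hl hl' hat hal ht ht' hcof using key
  obtain ⟨X', rfl, hX'⟩ := CoDelta.exists_lift X Y t (fun k m α h => l m α h)
    (fun k m α h => hl m α h) (fun i k m α β h => hl' m α β h)
  simp only [eqToHom_refl, Category.comp_id, Category.id_comp] at hX'
  -- Naturality has content only for morphisms that raise dimension, the others being identities.
  have nat {F G : CoDelta C} (φ : ∀ m, F.obj m ⟶ G.obj m)
      (h : ∀ ⦃k m : InjDelta⦄ (α : k ⟶ m), k.len < m.len → F.map α ≫ φ m = φ k ≫ G.map α)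
      ⦃k m : InjDelta⦄ (α : k ⟶ m) : F.map α ≫ φ m = φ k ≫ G.map α := by
    by_cases hk : k.len < m.len
    · exact h α hk
    · obtain rfl := eq_of_len_eq (le_antisymm (len_le_of_hom α) (not_lt.1 hk))
      obtain rfl := endo_eq_id α
      simp
  let T : X' ⟶ X :=
    { app := t
      naturality := nat (F := X') (G := X) t fun k m α h => by
        rw [hX' α h, Category.assoc, hl] }
  let A' : A ⟶ X' :=
    { app := a'
      naturality := nat (F := A) (G := X') a' fun k m α h => by
        rw [hX' α h, hal m α h, ← hat, Category.assoc] }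
  have hAT : A' ≫ T = a := by
    ext m
    exact hat m
  refine ⟨X', A', T, hAT, ht, ht', fun m hm => ?_⟩
  by_cases hmn : m.len = n
  · obtain ⟨L, M, P, inl, inr, hP, c, hc, hac, hMc⟩ := hcof m hmn
    have hT : ∀ i : InjDelta, i.len < m.len → IsIso (T.app i) := fun i hi => ht i (by omega)
    -- `T` is invertible below dimension `n`, so `X` and `X'` have the same latching object there.
    let M' := M.ofIsIso T hT
    have := isIso_latchingObjectMap T hT M' M
    have e : latchingObjectMap A' L M' ≫ latchingObjectMap T M' M = latchingObjectMap a L M := by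
      rw [← latchingObjectMap_comp, hAT]
    have hP' : IsPushout (latchingMap L) (latchingObjectMap A' L M') inl
        (latchingObjectMap T M' M ≫ inr) := by
      refine IsPushout.of_iso hP (Iso.refl _) (Iso.refl _)
        (asIso (latchingObjectMap T M' M)).symm (Iso.refl _) ?_ ?_ ?_ ?_
      · simp
      · simp [← e]
      · simp
      · simp
    refine CofibrationAt.mk' hP' (r := c) hac (M'.hom_ext fun i α h => ?_) hc
    rw [Category.assoc, ι_latchingObjectMap_assoc, hMc, LatchingObject.ι_latchingMap, hX' α h]
  · refine hC.cofibrationAt_of_comp (g := T) (fun i hi => ht i (by omega)) (hA m) ?_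
    rw [hAT]
    exact ha m (by omega)

end IsCofibrationCategory

/-- In dimension `m` the tower is constant from stage `m + 1` on, so the limit exists dimensionwise
and is attained there. -/
theorem exists_limit_of_eventually_isIso (X : ℕ → CoDelta C) (t : ∀ n, X (n + 1) ⟶ X n)
    (ht : ∀ n (m : InjDelta), m.len ≠ n → IsIso ((t n).app m)) :
    ∃ (Z : CoDelta C) (π : ∀ n, Z ⟶ X n), (∀ n, π (n + 1) ≫ t n = π n) ∧
      (∀ n (m : InjDelta), m.len < n → IsIso ((π n).app m)) ∧
      ∀ (A : CoDelta C) (a : ∀ n, A ⟶ X n), (∀ n, a (n + 1) ≫ t n = a n) →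
        ∃ l : A ⟶ Z, ∀ n, l ≫ π n = a n := by
  let F : ℕᵒᵖ ⥤ CoDelta C := Functor.ofOpSequence t
  have hF (m : InjDelta) (n k : ℕ) (hnk : n ≤ k) (hn : m.len < n) :
      IsIso ((F.map (homOfLE hnk).op).app m) := by
    induction k, hnk using Nat.le_induction with
    | base => exact inferInstanceAs (IsIso ((F.map (𝟙 _)).app m))
    | succ k hk ih =>
      have e : F.map (homOfLE (hk.trans k.le_succ)).op =
          F.map (homOfLE k.le_succ).op ≫ F.map (homOfLE hk).op := by
        rw [← Functor.map_comp]
        rfl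
      have : IsIso ((F.map (homOfLE k.le_succ).op).app m) :=
        Eq.mpr (congrArg (fun f : X (k + 1) ⟶ X k => IsIso (f.app m))
          (Functor.ofOpSequence_map_homOfLE_succ t k)) (ht k m (by omega))
      rw [e, NatTrans.comp_app]
      infer_instance
  have hev (m : InjDelta) : (F ⋙ (evaluation InjDelta C).obj m).IsEventuallyConstantTo
      (Opposite.op (m.len + 1)) := fun j f =>
    hF m _ _ (leOfHom f.unop) (Nat.lt_succ_self _)
  have (m : InjDelta) : HasLimit (F.flip.obj m) := (hev m).hasLimit
  refine ⟨limit F, fun n => limit.π F (Opposite.op n), fun n => ?_, fun n m hm => ?_,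
    fun A a ha => ?_⟩
  · rw [← Functor.ofOpSequence_map_homOfLE_succ t n]
    exact limit.w F _
  · exact (hev m).isIso_π_of_isLimit'
      (isLimitOfPreserves ((evaluation InjDelta C).obj m) (limit.isLimit F)) (Opposite.op n)
      (homOfLE hm).op
  · let c : Cone F :=
      { pt := A
        π := NatTrans.ofOpSequence a fun n => by
          simp only [F, Functor.ofOpSequence_map_homOfLE_succ]
          exact (Category.id_comp _).trans (ha n).symm }
    exact ⟨limit.lift F c, fun n => limit.lift_π c _⟩

/-- A factorization of a morphism of co-`Δ`-objects whose first factor is a cofibration below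
dimension `n`. -/
structure PartialFactorization (cof weq : MorphismProperty C) {A B : CoDelta C} (f : A ⟶ B)
    (n : ℕ) where
  X : CoDelta C
  a : A ⟶ X
  p : X ⟶ B
  fac : a ≫ p = f
  weq_p : levelEquivalences weq p
  cofibrationAt_a : ∀ m : InjDelta, m.len < n → CofibrationAt cof a m

namespace IsCofibrationCategory

variable {cof weq : MorphismProperty C} (hC : IsCofibrationCategory cof weq)
include hC

/-- Every morphism from a cofibrant co-`Δ`-object factors as a cofibration followed by a level
equivalence. -/
theorem exists_coDelta_factorization {A B : CoDelta C} (hA : IsCofibrantCoDelta cof A)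
    (f : A ⟶ B) :
    ∃ (Z : CoDelta C) (i : A ⟶ Z) (p : Z ⟶ B),
      coDeltaCofibrations cof i ∧ levelEquivalences weq p ∧ i ≫ p = f := by
  have step (n : ℕ) (s : PartialFactorization cof weq f n) :
      ∃ (s' : PartialFactorization cof weq f (n + 1)) (t : s'.X ⟶ s.X),
        s'.a ≫ t = s.a ∧ t ≫ s.p = s'.p ∧ ∀ m : InjDelta, m.len ≠ n → IsIso (t.app m) := by
    obtain ⟨X', a', t, hat, ht, ht', ha'⟩ :=
      hC.exists_factorization_step hA s.a n s.cofibrationAt_a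
    exact ⟨⟨X', a', t ≫ s.p, by rw [← Category.assoc, hat, s.fac],
      fun m => hC.weq_comp (ht' m) (s.weq_p m), ha'⟩, t, hat, rfl, ht⟩
  choose next t hat htp ht using step
  -- The tower starts with `f` followed by the identity of `B`; the condition below dimension `0` is
  -- vacuous.
  let seq (n : ℕ) : PartialFactorization cof weq f n :=
    Nat.rec ⟨B, f, 𝟙 B, Category.comp_id f, fun m => hC.weq_id _,
      fun m hm => (Nat.not_lt_zero _ hm).elim⟩ next n
  obtain ⟨Z, π, hπ, hπ', hZ⟩ := exists_limit_of_eventually_isIso (fun n => (seq n).X)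
    (fun n => t n (seq n)) (fun n => ht n (seq n))
  obtain ⟨i, hi⟩ := hZ A (fun n => (seq n).a) (fun n => hat n (seq n))
  have hp (n : ℕ) : π n ≫ (seq n).p = π 0 ≫ (seq 0).p := by
    induction n with
    | zero => rfl
    | succ n ih =>
      rw [← ih, ← hπ n, Category.assoc]
      exact congrArg (π (n + 1) ≫ ·) (htp n (seq n)).symm
  refine ⟨Z, i, π 0 ≫ (seq 0).p, fun m => ?_, fun m => ?_, ?_⟩
  · refine hC.cofibrationAt_of_comp (g := π (m.len + 1))
      (fun k hk => hπ' _ _ (Nat.lt_succ_of_le hk)) (hA m) ?_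
    rw [hi]
    exact (seq _).cofibrationAt_a m (Nat.lt_succ_self _)
  · rw [← hp (m.len + 1), NatTrans.comp_app]
    have := hπ' (m.len + 1) m (Nat.lt_succ_self _)
    exact hC.weq_comp (hC.weq_of_isIso _ inferInstance) ((seq _).weq_p m)
  · rw [← Category.assoc, hi, (seq 0).fac]

end IsCofibrationCategory

/-! ### Pushouts and composites of cofibrations of co-`Δ`-objects -/

theorem exists_isPushout_of_hasPushout_app {A B D : CoDelta C} (f : A ⟶ D) (i : A ⟶ B)
    (h : ∀ n, HasPushout (f.app n) (i.app n)) :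
    ∃ (P : CoDelta C) (j : D ⟶ P) (g : B ⟶ P),
      ∀ n, IsPushout (f.app n) (i.app n) (j.app n) (g.app n) := by
  have (n : InjDelta) : HasColimit ((span f i).flip.obj n) :=
    have := h n
    hasColimit_of_iso (F := span (f.app n) (i.app n)) (diagramIsoSpan _)
  exact ⟨pushout f i, pushout.inl f i, pushout.inr f i, fun n =>
    (IsPushout.of_hasPushout f i).map ((evaluation InjDelta C).obj n)⟩

/-- Latching objects commute with levelwise pushouts. -/
theorem LatchingObject.exists_isPushout {A B D P : CoDelta C} {f : A ⟶ D} {i : A ⟶ B} {j : D ⟶ P}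
    {g : B ⟶ P} (h : ∀ n, IsPushout (f.app n) (i.app n) (j.app n) (g.app n)) {n : InjDelta}
    (LA : LatchingObject A n) (LB : LatchingObject B n) (LD : LatchingObject D n)
    (hp : HasPushout (latchingObjectMap f LA LD) (latchingObjectMap i LA LB)) :
    ∃ LP : LatchingObject P n,
      IsPushout (latchingObjectMap f LA LD) (latchingObjectMap i LA LB)
        (latchingObjectMap j LD LP) (latchingObjectMap g LB LP) := by
  have hQ := IsPushout.of_hasPushout (latchingObjectMap f LA LD) (latchingObjectMap i LA LB)
  generalize pushout (latchingObjectMap f LA LD) (latchingObjectMap i LA LB) = Q,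
    pushout.inl (latchingObjectMap f LA LD) (latchingObjectMap i LA LB) = u,
    pushout.inr (latchingObjectMap f LA LD) (latchingObjectMap i LA LB) = v at hQ
  let ι ⦃k : InjDelta⦄ (α : k ⟶ n) (hk : k.len < n.len) : P.obj k ⟶ Q :=
    (h k).desc (LD.ι α hk ≫ u) (LB.ι α hk ≫ v) (by
      rw [← ι_latchingObjectMap_assoc f LA LD, ← ι_latchingObjectMap_assoc i LA LB, hQ.w])
  have hιj ⦃k : InjDelta⦄ (α : k ⟶ n) (hk : k.len < n.len) :
    j.app k ≫ ι α hk = LD.ι α hk ≫ u := (h k).inl_desc _ _ _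
  have hιg ⦃k : InjDelta⦄ (α : k ⟶ n) (hk : k.len < n.len) :
    g.app k ≫ ι α hk = LB.ι α hk ≫ v := (h k).inr_desc _ _ _
  clear_value ι
  have hι : IsFaceColimit P (boundary n) Q ι := by
    refine ⟨fun k m β α (hk : k.len < n.len) => ?_, fun X x hx => ?_, fun X d d' hd => ?_⟩
    · have hm := lt_of_le_of_lt (len_le_of_hom β) hk
      refine (h m).hom_ext ?_ ?_
      · refine Eq.trans ?_ (hιj (β ≫ α) hm).symm
        rw [← map_ι_assoc LD β α hk, ← j.naturality_assoc, hιj]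
      · refine Eq.trans ?_ (hιg (β ≫ α) hm).symm
        rw [← map_ι_assoc LB β α hk, ← g.naturality_assoc, hιg]
    · obtain ⟨d, hd⟩ := LD.exists_desc (fun k α hk => j.app k ≫ x α hk) fun k m β α hk => by
        rw [j.naturality_assoc]
        exact congrArg (j.app m ≫ ·) (hx β α hk)
      obtain ⟨e, he⟩ := LB.exists_desc (fun k α hk => g.app k ≫ x α hk) fun k m β α hk => by
        rw [g.naturality_assoc]
        exact congrArg (g.app m ≫ ·) (hx β α hk)
      obtain ⟨q, hq₁, hq₂⟩ := hQ.exists_desc d e (LA.hom_ext fun k α hk => by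
        rw [ι_latchingObjectMap_assoc, ι_latchingObjectMap_assoc, hd, he, reassoc_of% (h k).w])
      refine ⟨q, fun k α hk => (h k).hom_ext ?_ ?_⟩
      · exact ((Category.assoc _ _ _).symm.trans (congrArg (· ≫ q) (hιj α hk))).trans
          ((Category.assoc _ _ _).trans ((congrArg (LD.ι α hk ≫ ·) hq₁).trans (hd α hk)))
      · exact ((Category.assoc _ _ _).symm.trans (congrArg (· ≫ q) (hιg α hk))).trans
          ((Category.assoc _ _ _).trans ((congrArg (LB.ι α hk ≫ ·) hq₂).trans (he α hk)))
    · refine hQ.hom_ext (LD.hom_ext fun k α hk => ?_) (LB.hom_ext fun k α hk => ?_)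
      · rw [← reassoc_of% hιj, ← reassoc_of% hιj]
        exact congrArg (j.app k ≫ ·) (hd α hk)
      · rw [← reassoc_of% hιg, ← reassoc_of% hιg]
        exact congrArg (g.app k ≫ ·) (hd α hk)
  have e₁ : latchingObjectMap j LD hι.latchingObject = u := LD.hom_ext fun k α hk =>
    (ι_latchingObjectMap _ _ _ _ _).trans (hιj α hk)
  have e₂ : latchingObjectMap g LB hι.latchingObject = v := LB.hom_ext fun k α hk =>
    (ι_latchingObjectMap _ _ _ _ _).trans (hιg α hk)
  exact ⟨hι.latchingObject, by rw [e₁, e₂]; exact hQ⟩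

/-- All latching objects of `A` are initial as well, so the relative latching map is just the
latching map of `B`. -/
theorem coDeltaCofibrations_of_isInitial_obj {cof : MorphismProperty C} {A B : CoDelta C}
    (f : A ⟶ B)
    (hA : IsCofibrantCoDelta cof A) (hB : IsCofibrantCoDelta cof B)
    (h : ∀ n, IsInitial (A.obj n)) : coDeltaCofibrations cof f := by
  intro n
  obtain ⟨L, -⟩ := hA n
  obtain ⟨M, hM⟩ := hB n
  have : IsIso (latchingMap L) :=
    ⟨(h n).to _, L.hom_ext fun i α hi => (h i).hom_ext _ _, (h n).hom_ext _ _⟩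
  exact CofibrationAt.mk' (inl := (h n).to _) (inr := 𝟙 _)
    (IsPushout.of_horiz_isIso ⟨L.hom_ext fun i α hi => (h i).hom_ext _ _⟩) (r := latchingMap M)
    ((h n).hom_ext _ _) (by simp) hM

namespace IsCofibrationCategory

variable {cof weq : MorphismProperty C} (hC : IsCofibrationCategory cof weq)
include hC

/-- The relative latching map of `j` is a cobase change of that of `i`, by cancelling pushout
squares. -/
theorem coDeltaCofibrations_of_isPushout {A B D P : CoDelta C} {f : A ⟶ D} {i : A ⟶ B} {j : D ⟶ P}
    {g : B ⟶ P} (h : ∀ n, IsPushout (f.app n) (i.app n) (j.app n) (g.app n))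
    (hA : IsCofibrantCoDelta cof A) (hD : IsCofibrantCoDelta cof D)
    (hi : coDeltaCofibrations cof i) : coDeltaCofibrations cof j := by
  intro n
  obtain ⟨LA, LB, R, inl, inr, hR, hr⟩ := hi n
  obtain ⟨LD, hLD⟩ := hD n
  obtain ⟨LP, hP⟩ := LatchingObject.exists_isPushout h LA LB LD
    (hC.hasPushout _ _ (hC.cof_latchingObjectMap i (fun m _ => hA m) (fun m _ => hi m) LA LB))
  obtain ⟨S, inr', inl', hS, -⟩ := hC.exists_pushout _ (latchingObjectMap j LD LP) hLD
  let ρ : R ⟶ S := hR.desc (f.app n ≫ inl') (latchingObjectMap g LB LP ≫ inr') (by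
    rw [← Category.assoc, latchingMap_naturality f LA LD, Category.assoc, ← hS.w, hP.w_assoc])
  have h₁ : IsPushout (f.app n) inl inl' ρ := by
    refine IsPushout.of_left (h₁₁ := latchingMap LA) (v₁₁ := latchingObjectMap i LA LB)
      (h₂₁ := inr) ?_ (by simp [ρ]) hR
    simpa [ρ, latchingMap_naturality f LA LD] using hP.paste_horiz hS.flip
  have h₂ : IsPushout ρ (hR.desc (i.app n) (latchingMap LB) (latchingMap_naturality i LA LB))
      (hS.flip.desc (j.app n) (latchingMap LP) (latchingMap_naturality j LD LP)) (g.app n) := by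
    refine IsPushout.of_top (h₁₁ := f.app n) (v₁₁ := inl) (v₁₂ := inl') ?_ ?_ h₁
    · simpa using h n
    · apply hR.hom_ext
      · simp [ρ, (h n).w]
      · simp [ρ, latchingMap_naturality g LB LP]
  exact ⟨LD, LP, S, inl', inr', hS.flip, hC.cof_of_isPushout h₂ hr⟩

/-- The relative latching map of `f ≫ g` is a cobase change of that of `f`, followed by that of `g`.
-/
theorem coDeltaCofibrations_comp {A B D : CoDelta C} {f : A ⟶ B} {g : B ⟶ D}
    (hA : IsCofibrantCoDelta cof A) (hB : IsCofibrantCoDelta cof B)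
    (hf : coDeltaCofibrations cof f) (hg : coDeltaCofibrations cof g) :
    coDeltaCofibrations cof (f ≫ g) := by
  intro n
  obtain ⟨L, M, R, inl, inr, hR, hr⟩ := hf n
  have ⟨_, N, _⟩ := hg n
  obtain ⟨S, inr', inl', hS, -⟩ := hC.exists_pushout _ (latchingObjectMap g M N)
    (hC.cof_latchingMap (hB n) M)
  -- The two hypotheses come with possibly different latching objects of `B`; here `hg` is moved to
  -- the one chosen by `hf`.
  have hr' := hC.cof_of_cofibrationAt (hg n) hS.flip
    (hS.flip.inl_desc _ _ (latchingMap_naturality g M N))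
    (hS.flip.inr_desc _ _ (latchingMap_naturality g M N))
  obtain ⟨T, l, k, hT, -⟩ := hC.exists_pushout _ (latchingObjectMap (f ≫ g) L N)
    (hC.cof_latchingMap (hA n) L)
  have e := latchingObjectMap_comp f g L M N
  let τ : T ⟶ S := hT.flip.desc (f.app n ≫ inl') inr' (by
    rw [← Category.assoc, latchingMap_naturality f L M, Category.assoc, ← hS.w, e, Category.assoc])
  let σ : R ⟶ T := hR.desc k (latchingObjectMap g M N ≫ l) (by
    rw [← hT.w, e, Category.assoc])
  have h₁ : IsPushout inr (latchingObjectMap g M N) σ l := by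
    refine IsPushout.of_top (h₁₁ := latchingMap L) (v₁₁ := latchingObjectMap f L M)
      (v₁₂ := inl) ?_ (by simp [σ]) hR
    simpa [σ, e] using hT.flip
  have h₂ : IsPushout (hR.desc (f.app n) (latchingMap M) (latchingMap_naturality f L M)) σ
      inl' τ := by
    refine IsPushout.of_left (h₁₁ := inr) (v₁₁ := latchingObjectMap g M N) (h₂₁ := l) ?_ ?_ h₁
    · simpa [τ] using hS.flip
    · apply hR.hom_ext
      · simp [σ, τ]
      · simp [σ, τ, hS.w]
  refine CofibrationAt.mk' hT.flip (r := τ ≫ hS.flip.desc (g.app n) (latchingMap N) _) ?_ ?_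
    (hC.cof_comp _ _ (hC.cof_of_isPushout h₂.flip hr) hr')
  · simp [τ]
  · simp [τ]

theorem coDeltaCofibrations_of_isIso {A B : CoDelta C} (f : A ⟶ B) [IsIso f]
    (hA : IsCofibrantCoDelta cof A) (hB : IsCofibrantCoDelta cof B) :
    coDeltaCofibrations cof f := by
  intro n
  obtain ⟨L, -⟩ := hA n
  obtain ⟨M, -⟩ := hB n
  have := isIso_latchingObjectMap f (fun _ _ => inferInstance) L M
  exact CofibrationAt.mk' (IsPushout.of_vert_isIso ⟨latchingMap_naturality f L M⟩) (r := 𝟙 _)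
    (by simp) (by simp) (hC.cof_of_isIso _ inferInstance)

/-! ### The cofibration category of frames -/

theorem isFrame_const {I : C} (hI : IsInitial I) :
    IsFrame cof weq ((Functor.const InjDelta).obj I) := by
  refine ⟨fun n => ?_, fun m n α => hC.weq_id I⟩
  have h : IsFaceColimit ((Functor.const InjDelta).obj I) (boundary n) I (fun _ _ _ => 𝟙 I) :=
    ⟨fun _ _ _ _ _ => Category.comp_id _, fun X x _ => ⟨hI.to X, fun _ _ _ => hI.hom_ext _ _⟩,
      fun _ _ _ _ => hI.hom_ext _ _⟩
  exact ⟨h.latchingObject, hC.cof_of_isInitial _ ⟨hI⟩⟩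

theorem hasInitial_frameCat : HasInitial (FrameCat cof weq) := by
  have := hC.hasInitial
  let I : FrameCat cof weq := ⟨_, hC.isFrame_const (initialIsInitial (C := C))⟩
  refine IsInitial.hasInitial (X := I) (IsInitial.ofUniqueHom
    (fun Y => ObjectProperty.homMk
      { app := fun n => initial.to _
        naturality := fun _ _ _ => initialIsInitial.hom_ext _ _ }) fun Y f => ?_)
  ext n
  exact initialIsInitial.hom_ext _ _

/-- An initial frame is isomorphic to the constant frame on an initial object of `C`. -/
theorem isInitial_obj {X : FrameCat cof weq} (hX : IsInitial X) (n : InjDelta) :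
    Nonempty (IsInitial (X.obj.obj n)) := by
  have := hC.hasInitial
  let I : FrameCat cof weq := ⟨_, hC.isFrame_const (initialIsInitial (C := C))⟩
  let e : X.obj.obj n ⟶ ⊥_ C := (hX.to I).hom.app n
  refine ⟨IsInitial.ofIso initialIsInitial ⟨initial.to _, e, initialIsInitial.hom_ext _ _, ?_⟩⟩
  let t : I ⟶ X := ObjectProperty.homMk
    { app := fun n => initial.to _
      naturality := fun _ _ _ => initialIsInitial.hom_ext _ _ }
  exact congrArg (fun f : X ⟶ X => f.hom.app n) (hX.hom_ext (hX.to I ≫ t) (𝟙 X))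

theorem exists_frame_pushout {A B D : FrameCat cof weq} (i : A ⟶ B) (f : A ⟶ D)
    (hi : frameCofibrations cof weq i) :
    ∃ (P : FrameCat cof weq) (j : D ⟶ P) (g : B ⟶ P), frameCofibrations cof weq j ∧
      IsPushout f i j g ∧
      ∀ n, IsPushout (f.hom.app n) (i.hom.app n) (j.hom.app n) (g.hom.app n) := by
  have hi' := hC.cof_app i.hom A.property.1 hi
  obtain ⟨P, j, g, h⟩ := exists_isPushout_of_hasPushout_app f.hom i.hom
    fun n => hC.hasPushout _ _ (hi' n)
  have hj := hC.coDeltaCofibrations_of_isPushout h A.property.1 D.property.1 hi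
  have hP : IsFrame cof weq P :=
    ⟨fun n => hC.cofibrantAt_of_cofibrationAt (D.property.1 n) (hj n), fun m n α =>
      hC.weq_pushout_map (h m) (h n) (f.hom.naturality α).symm (i.hom.naturality α).symm
        (j.naturality α).symm (g.naturality α).symm (hi' m) (hi' n) (A.property.2 α)
        (B.property.2 α) (D.property.2 α)⟩
  exact ⟨⟨P, hP⟩, ObjectProperty.homMk j, ObjectProperty.homMk g, hj,
    IsPushout.of_map_of_faithful (IsFrame cof weq).ι (IsPushout.of_forall_isPushout_app h), h⟩

/-- Any pushout of frames along a cofibration is isomorphic to the dimensionwise one. -/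
theorem isPushout_frame_app {A B D P : FrameCat cof weq} {f : A ⟶ D} {i : A ⟶ B} {j : D ⟶ P}
    {g : B ⟶ P} (h : IsPushout f i j g) (hi : frameCofibrations cof weq i) (n : InjDelta) :
    IsPushout (f.hom.app n) (i.hom.app n) (j.hom.app n) (g.hom.app n) := by
  obtain ⟨P', j', g', -, h', h''⟩ := hC.exists_frame_pushout i f hi
  have := (h'.preservesColimit_span_iff
    (F := (IsFrame cof weq).ι ⋙ (evaluation InjDelta C).obj n)).2 (h'' n)
  exact h.map ((IsFrame cof weq).ι ⋙ (evaluation InjDelta C).obj n)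

/-- The target need not be cofibrant: besides the factorization axiom for frames, this supplies
frame replacements of arbitrary homotopically constant objects. -/
theorem exists_frame_factorization {A : FrameCat cof weq} {B : CoDelta C}
    (hB : ∀ ⦃m n : InjDelta⦄ (α : m ⟶ n), weq (B.map α)) (f : A.obj ⟶ B) :
    ∃ (Z : FrameCat cof weq) (i : A ⟶ Z) (p : Z.obj ⟶ B), frameCofibrations cof weq i ∧
      levelEquivalences weq p ∧ i.hom ≫ p = f := by
  obtain ⟨Z, i, p, hi, hp, e⟩ := hC.exists_coDelta_factorization A.property.1 f
  refine ⟨⟨Z, fun n => hC.cofibrantAt_of_cofibrationAt (A.property.1 n) (hi n), fun m n α => ?_⟩,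
    ObjectProperty.homMk i, p, hi, hp, e⟩
  refine hC.weq_of_postcomp (hp n) ?_
  rw [p.naturality]
  exact hC.weq_comp (hp m) (hB α)

theorem isCofibrationCategory_frameCat :
    IsCofibrationCategory (frameCofibrations cof weq) (frameEquivalences cof weq) where
  cof_of_isIso X Y f _ :=
    have : IsIso ((IsFrame cof weq).ι.map f) := inferInstance
    hC.coDeltaCofibrations_of_isIso ((IsFrame cof weq).ι.map f) X.property.1 Y.property.1
  weq_of_isIso X Y f _ n := hC.weq_of_isIso _
    (inferInstanceAs (IsIso (((IsFrame cof weq).ι ⋙ (evaluation InjDelta C).obj n).map f)))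
  cof_comp X Y Z f g hf hg := hC.coDeltaCofibrations_comp X.property.1 Y.property.1 hf hg
  hasInitial := hC.hasInitial_frameCat
  cof_of_isInitial X Y f h := coDeltaCofibrations_of_isInitial_obj _ X.property.1 Y.property.1
    fun n => (hC.isInitial_obj h.some n).some
  two_out_of_three :=
    { comp_mem := fun _ _ hf hg n => hC.weq_comp (hf n) (hg n)
      of_postcomp := fun _ _ hg hfg n => hC.weq_of_postcomp (hg n) (hfg n)
      of_precomp := fun _ _ hf hfg n => hC.weq_of_precomp (hf n) (hfg n) }
  exists_pushout A B D i f hi := by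
    obtain ⟨P, j, g, hj, h, h'⟩ := hC.exists_frame_pushout i f hi
    exact ⟨P, j, g, h, hj, fun hi' n =>
      hC.weq_of_isPushout (h' n) (hC.cof_app i.hom A.property.1 hi n) (hi' n)⟩
  exists_factorization X Y f := by
    obtain ⟨Z, i, p, hi, hp, e⟩ := hC.exists_frame_factorization Y.property.2 f.hom
    exact ⟨Z, i, ObjectProperty.homMk p, hi, hp, by ext1; exact e⟩

theorem isExactFunctor_frameEvalZero :
    IsExactFunctor (frameCofibrations cof weq) (frameEquivalences cof weq) cof weq
      (frameEvalZero cof weq) where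
  map_initial _ h := hC.isInitial_obj h.some ⟨0⟩
  map_cof X _ f hf := hC.cof_app f.hom X.property.1 hf ⟨0⟩
  map_weq _ _ _ hf := hf ⟨0⟩
  map_pushout _ _ _ _ _ _ _ _ hi h := hC.isPushout_frame_app h hi ⟨0⟩

end IsCofibrationCategory

end Latching

/-! ### Cofibrant approximation with values in the homotopy category -/

/-- A functor `I` from a cofibration category to a category with weak equivalences that reflects
weak equivalences, preserves initial objects and pushouts along cofibrations, and such that every
morphism `I A ⟶ Y` factors as the image of a cofibration followed by a weak equivalence. -/
structure IsCofibrantApproximation {F : Type u} [Category.{v} F] {D : Type u'} [Category.{v'} D]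
    (cof W : MorphismProperty F) (W' : MorphismProperty D) (I : F ⥤ D) : Prop where
  isCofibrationCategory : IsCofibrationCategory cof W
  map_weq_iff : ∀ ⦃X Y : F⦄ (f : X ⟶ Y), W' (I.map f) ↔ W f
  two_out_of_three : W'.HasTwoOutOfThreeProperty
  weq_id : ∀ Y : D, W' (𝟙 Y)
  map_initial : ∀ X : F, Nonempty (IsInitial X) → Nonempty (IsInitial (I.obj X))
  map_pushout : ∀ ⦃A B C' P : F⦄ (f : A ⟶ C') (i : A ⟶ B) (j : C' ⟶ P) (g : B ⟶ P),
    cof i → IsPushout f i j g → IsPushout (I.map f) (I.map i) (I.map j) (I.map g)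
  exists_factorization : ∀ ⦃A : F⦄ ⦃Y : D⦄ (φ : I.obj A ⟶ Y),
    ∃ (Z : F) (i : A ⟶ Z) (p : I.obj Z ⟶ Y), cof i ∧ W' p ∧ I.map i ≫ p = φ

namespace IsCofibrantApproximation

variable {F : Type u} [Category.{v} F] {D : Type u'} [Category.{v'} D]
  {cof W : MorphismProperty F} {W' : MorphismProperty D} {I : F ⥤ D}
  (h : IsCofibrantApproximation cof W W' I)
include h

theorem weq_of_fac {X Z : F} {Y : D} {s : X ⟶ Z} {z : I.obj Z ⟶ Y} {p : I.obj X ⟶ Y}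
    (e : I.map s ≫ z = p) (hz : W' z) (hp : W' p) : W s := by
  have := h.two_out_of_three
  exact (h.map_weq_iff s).1 (W'.of_postcomp _ z hz (e ▸ hp))

/-- Binary coproducts exist in `F` and are preserved by `I`. -/
theorem exists_coprod (A B : F) : ∃ (S : F) (a : A ⟶ S) (b : B ⟶ S),
    (∀ ⦃X : F⦄ (f : A ⟶ X) (g : B ⟶ X), ∃ d : S ⟶ X, a ≫ d = f ∧ b ≫ d = g) ∧
    (∀ ⦃Y : D⦄ (f : I.obj A ⟶ Y) (g : I.obj B ⟶ Y),
      ∃ d : I.obj S ⟶ Y, I.map a ≫ d = f ∧ I.map b ≫ d = g) ∧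
    ∀ ⦃Y : D⦄ (d d' : I.obj S ⟶ Y), I.map a ≫ d = I.map a ≫ d' → I.map b ≫ d = I.map b ≫ d' →
      d = d' := by
  have hF := h.isCofibrationCategory
  have := hF.hasInitial
  have hi := hF.cof_of_isInitial (initial.to B) ⟨initialIsInitial⟩
  obtain ⟨S, a, b, hS, -⟩ := hF.exists_pushout (initial.to B) (initial.to A) hi
  have hS' := h.map_pushout _ _ _ _ hi hS
  obtain ⟨hI⟩ := h.map_initial _ ⟨initialIsInitial (C := F)⟩
  exact ⟨S, a, b, fun X f g => hS.exists_desc f g (initialIsInitial.hom_ext _ _),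
    fun Y f g => hS'.exists_desc f g (hI.hom_ext _ _), fun Y d d' => hS'.hom_ext⟩

/-- Factor the morphism out of the coproduct `I (A ⊔ B)`, which `I` preserves. -/
theorem exists_common_target {A B : F} {Y : D} (a : I.obj A ⟶ Y) (b : I.obj B ⟶ Y) :
    ∃ (Z : F) (f : A ⟶ Z) (g : B ⟶ Z) (z : I.obj Z ⟶ Y),
      W' z ∧ I.map f ≫ z = a ∧ I.map g ≫ z = b := by
  obtain ⟨S, f, g, -, hS, -⟩ := h.exists_coprod A B
  obtain ⟨d, hf, hg⟩ := hS a b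
  obtain ⟨Z, i, z, -, hz, e⟩ := h.exists_factorization d
  exact ⟨Z, f ≫ i, g ≫ i, z, hz, by simp [e, hf], by simp [e, hg]⟩

/-- Parallel morphisms that agree after composition with a weak equivalence become equal in the
homotopy category. -/
theorem Q_map_eq {A Z : F} {Y : D} (a b : A ⟶ Z) {z : I.obj Z ⟶ Y} (hz : W' z)
    (hab : I.map a ≫ z = I.map b ≫ z) : W.Q.map a = W.Q.map b := by
  have hF := h.isCofibrationCategory
  obtain ⟨S, f, g, hS, -, hS'⟩ := h.exists_coprod A A
  obtain ⟨c, hc₁, hc₂⟩ := hS a b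
  obtain ⟨d, hd₁, hd₂⟩ := hS (𝟙 A) (𝟙 A)
  -- The two ends of the cylinder agree in the homotopy category, since `q` retracts both. Gluing
  -- the cylinder to `Z` along `a` and `b` makes these homotopic in `V`. The equality over `Y`
  -- extends `z` to `V`; factoring that extension makes `Z ⟶ V'` a weak equivalence, which can be
  -- cancelled.
  obtain ⟨Cyl, e, q, he, hq, rfl⟩ := hF.exists_factorization d
  obtain ⟨V, k, l, hV, -⟩ := hF.exists_pushout e c he
  obtain ⟨w, hw₁, -⟩ := (h.map_pushout _ _ _ _ he hV).exists_desc z (I.map q ≫ I.map a ≫ z) (by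
    apply hS'
    · simp only [← Functor.map_comp_assoc, hc₁, reassoc_of% hd₁]
    · simp only [← Functor.map_comp_assoc, hc₂, reassoc_of% hd₂, hab])
  obtain ⟨V', i, w', -, hw', hw⟩ := h.exists_factorization w
  have hki : W (k ≫ i) := h.weq_of_fac (p := z) (by simp [hw, hw₁]) hw' hz
  have := W.Q_inverts _ hq
  have := W.Q_inverts _ hki
  have hfg : W.Q.map (f ≫ e) = W.Q.map (g ≫ e) := by
    rw [← cancel_mono (W.Q.map q), ← Functor.map_comp, ← Functor.map_comp, Category.assoc,
      Category.assoc, hd₁, hd₂]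
  rw [← cancel_mono (W.Q.map (k ≫ i)), ← Functor.map_comp, ← Functor.map_comp, ← hc₁, ← hc₂]
  simp only [Category.assoc, reassoc_of% hV.w]
  simp only [← Category.assoc, Functor.map_comp] at hfg ⊢
  rw [hfg]

end IsCofibrantApproximation

section Lift

variable {F : Type u} [Category.{v} F] {D : Type u'} [Category.{v'} D]

/-- `φ` is the morphism `s⁻¹ b` in the homotopy category, where `a` and `p` factor through `b` and
`s` followed by a common weak equivalence. -/
def IsHomotopyLift (W : MorphismProperty F) (W' : MorphismProperty D) {I : F ⥤ D} {A Q : F} {Y : D}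
    (p : I.obj Q ⟶ Y) (a : I.obj A ⟶ Y) (φ : W.Q.obj A ⟶ W.Q.obj Q) : Prop :=
  ∃ (Z : F) (b : A ⟶ Z) (s : Q ⟶ Z) (z : I.obj Z ⟶ Y),
    W' z ∧ I.map b ≫ z = a ∧ I.map s ≫ z = p ∧ φ ≫ W.Q.map s = W.Q.map b

end Lift

namespace IsCofibrantApproximation

variable {F : Type u} [Category.{v} F] {D : Type u'} [Category.{v'} D]
  {cof W : MorphismProperty F} {W' : MorphismProperty D} {I : F ⥤ D}
  (h : IsCofibrantApproximation cof W W' I)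
include h

variable {A Q Q' : F} {Y Y' : D} {p : I.obj Q ⟶ Y} {p' : I.obj Q' ⟶ Y'}

theorem exists_isHomotopyLift (hp : W' p) (a : I.obj A ⟶ Y) :
    ∃ φ : W.Q.obj A ⟶ W.Q.obj Q, IsHomotopyLift W W' p a φ := by
  obtain ⟨Z, b, s, z, hz, hb, hs⟩ := h.exists_common_target a p
  have := W.Q_inverts _ (h.weq_of_fac hs hz hp)
  exact ⟨W.Q.map b ≫ inv (W.Q.map s), Z, b, s, z, hz, hb, hs, by simp⟩

/-- Two choices of `Z` map to a common `T` over `Y`; there the composites of the numerators, and of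
the denominators, agree over `Y`, so `Q_map_eq` identifies them. -/
theorem isHomotopyLift_unique (hp : W' p) {a : I.obj A ⟶ Y} {φ φ' : W.Q.obj A ⟶ W.Q.obj Q}
    (hφ : IsHomotopyLift W W' p a φ) (hφ' : IsHomotopyLift W W' p a φ') : φ = φ' := by
  obtain ⟨Z, b, s, z, hz, hb, hs, e⟩ := hφ
  obtain ⟨Z', b', s', z', hz', hb', hs', e'⟩ := hφ'
  obtain ⟨T, t, t', y, hy, ht, ht'⟩ := h.exists_common_target z z'
  have h₁ : W.Q.map (b ≫ t) = W.Q.map (b' ≫ t') :=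
    h.Q_map_eq _ _ hy (by simp [ht, ht', hb, hb'])
  have h₂ : W.Q.map (s ≫ t) = W.Q.map (s' ≫ t') :=
    h.Q_map_eq _ _ hy (by simp [ht, ht', hs, hs'])
  have := W.Q_inverts _ (h.weq_of_fac (s := s ≫ t) (p := p) (by simp [ht, hs]) hy hp)
  rw [← cancel_mono (W.Q.map (s ≫ t))]
  conv_rhs => rw [h₂]
  rw [Functor.map_comp, Functor.map_comp, reassoc_of% e, reassoc_of% e', ← Functor.map_comp, h₁,
    Functor.map_comp]

/-- The morphism in the homotopy category from `A` to a cofibrant approximation of `Y` that is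
induced by a morphism `I A ⟶ Y`. -/
noncomputable def lift (hp : W' p) (a : I.obj A ⟶ Y) : W.Q.obj A ⟶ W.Q.obj Q :=
  (h.exists_isHomotopyLift hp a).choose

theorem isHomotopyLift_lift (hp : W' p) (a : I.obj A ⟶ Y) :
    IsHomotopyLift W W' p a (h.lift hp a) :=
  (h.exists_isHomotopyLift hp a).choose_spec

theorem lift_self (hp : W' p) : h.lift hp p = 𝟙 _ :=
  h.isHomotopyLift_unique hp (h.isHomotopyLift_lift hp p)
    ⟨Q, 𝟙 Q, 𝟙 Q, p, hp, by simp, by simp, by simp⟩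

theorem map_lift {A' : F} (hp : W' p) (f : A' ⟶ A) (a : I.obj A ⟶ Y) :
    h.lift hp (I.map f ≫ a) = W.Q.map f ≫ h.lift hp a := by
  refine h.isHomotopyLift_unique hp (h.isHomotopyLift_lift hp _) ?_
  obtain ⟨Z, b, s, z, hz, hb, hs, e⟩ := h.isHomotopyLift_lift hp a
  exact ⟨Z, f ≫ b, s, z, hz, by simp [hb], hs, by simp [e]⟩

theorem lift_comp (hp : W' p) (hp' : W' p') (a : I.obj A ⟶ Y) (g : Y ⟶ Y') :
    h.lift hp a ≫ h.lift hp' (p ≫ g) = h.lift hp' (a ≫ g) := by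
  obtain ⟨Z, b, s, z, hz, hb, hs, e⟩ := h.isHomotopyLift_lift hp a
  have hs' : p ≫ g = I.map s ≫ z ≫ g := by rw [reassoc_of% hs]
  have hb' : a ≫ g = I.map b ≫ z ≫ g := by rw [reassoc_of% hb]
  rw [hs', hb', h.map_lift, h.map_lift, reassoc_of% e]

theorem isIso_lift (hp : W' p) {a : I.obj A ⟶ Y} (ha : W' a) : IsIso (h.lift hp a) := by
  obtain ⟨Z, b, s, z, hz, hb, hs, e⟩ := h.isHomotopyLift_lift hp a
  have := W.Q_inverts _ (h.weq_of_fac hb hz ha)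
  have := W.Q_inverts _ (h.weq_of_fac hs hz hp)
  rw [← IsIso.eq_comp_inv] at e
  rw [e]
  infer_instance

theorem exists_replacement (Y : D) : ∃ (Q : F) (p : I.obj Q ⟶ Y), W' p := by
  have := h.isCofibrationCategory.hasInitial
  obtain ⟨hI⟩ := h.map_initial _ ⟨initialIsInitial (C := F)⟩
  obtain ⟨Z, -, p, -, hp, -⟩ := h.exists_factorization (hI.to Y)
  exact ⟨Z, p, hp⟩

/-- A chosen cofibrant approximation. -/
noncomputable def approx (Y : D) : F := (h.exists_replacement Y).choose

/-- The weak equivalence from a chosen cofibrant approximation. -/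
noncomputable def approxMap (Y : D) : I.obj (h.approx Y) ⟶ Y :=
  (h.exists_replacement Y).choose_spec.choose

theorem weq_approxMap (Y : D) : W' (h.approxMap Y) :=
  (h.exists_replacement Y).choose_spec.choose_spec

/-- Cofibrant approximation as a functor to the homotopy category. -/
noncomputable def approxFunctor : D ⥤ HomotopyCat W where
  obj Y := W.Q.obj (h.approx Y)
  map {Y Y'} g := h.lift (h.weq_approxMap Y') (h.approxMap Y ≫ g)
  map_id Y := by rw [Category.comp_id, h.lift_self]
  map_comp f g := by rw [h.lift_comp, Category.assoc]

theorem isIso_approxFunctor_map {Y Y' : D} {g : Y ⟶ Y'} (hg : W' g) :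
    IsIso (h.approxFunctor.map g) := by
  have := h.two_out_of_three
  exact h.isIso_lift (h.weq_approxMap Y') (W'.comp_mem _ _ (h.weq_approxMap Y) hg)

/-- Cofibrant approximation restricts to the localization functor. -/
noncomputable def approxFunctorRestriction : W.Q ≅ I ⋙ h.approxFunctor :=
  NatIso.ofComponents
    (fun A => @asIso _ _ _ _ (h.lift (h.weq_approxMap (I.obj A)) (𝟙 (I.obj A)))
      (h.isIso_lift (h.weq_approxMap (I.obj A)) (h.weq_id (I.obj A)))) fun {A B} f => by
    dsimp [approxFunctor]
    rw [← h.map_lift, h.lift_comp, Category.id_comp, Category.comp_id]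

/-- A functor on `D` that inverts weak equivalences is determined by its restriction to `F`. -/
noncomputable def approxFunctorCompIso {T : Type u''} [Category.{v''} T] (H : HomotopyCat W ⥤ T)
    (K : D ⥤ T) (hK : ∀ ⦃X Y : D⦄ (f : X ⟶ Y), W' f → IsIso (K.map f))
    (e : W.Q ⋙ H ≅ I ⋙ K) : h.approxFunctor ⋙ H ≅ K :=
  NatIso.ofComponents
    (fun Y => have := hK _ (h.weq_approxMap Y)
      e.app (h.approx Y) ≪≫ asIso (K.map (h.approxMap Y))) fun {Y Y'} g => by
    obtain ⟨Z, b, s, z, hz, hb, hs, hbs⟩ :=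
      h.isHomotopyLift_lift (h.weq_approxMap Y') (h.approxMap Y ≫ g)
    have h₁ := e.hom.naturality s
    have h₂ := e.hom.naturality b
    dsimp [approxFunctor] at h₁ h₂ ⊢
    have h₃ : K.map (h.approxMap Y') = K.map (I.map s) ≫ K.map z := by rw [← K.map_comp, hs]
    have h₄ : K.map (h.approxMap Y) ≫ K.map g = K.map (I.map b) ≫ K.map z := by
      rw [← K.map_comp, ← K.map_comp, hb]
    rw [Category.assoc, h₃, h₄, ← reassoc_of% h₁,
      ← reassoc_of% h₂, ← hbs, H.map_comp, Category.assoc]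

end IsCofibrantApproximation

/-! ### The cone zigzag and the inverse of the derived functor -/

namespace InjDelta

/-- The functor `[n] ↦ [0] ⋆ [n]` that adds a minimal element. -/
def cone : InjDelta ⥤ InjDelta where
  obj n := ⟨n.len + 1⟩
  map {m n} f :=
    let f' : Fin (m.len + 1) ↪o Fin (n.len + 1) := f
    OrderEmbedding.ofStrictMono (fun x => Fin.cases 0 (fun i => (f' i).succ) x) <| by
      intro x y
      induction x using Fin.cases <;> induction y using Fin.cases <;> simp
  map_id m := by
    ext x
    refine congrArg Fin.val (?_ : Fin.cases 0 (fun i => i.succ) x = x)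
    induction x using Fin.cases <;> rfl
  map_comp f g := by
    ext x
    induction x using Fin.cases <;> rfl

/-- The inclusion `[n] ⟶ [0] ⋆ [n]`. -/
def toCone : 𝟭 InjDelta ⟶ cone where
  app n := Fin.succOrderEmb (n.len + 1)
  naturality _ _ _ := rfl

/-- The inclusion `[0] ⟶ [0] ⋆ [n]`. -/
def vertexToCone : (Functor.const InjDelta).obj ⟨0⟩ ⟶ cone where
  app n := show Fin 1 ↪o Fin (n.len + 2) from
    OrderEmbedding.ofStrictMono (fun _ => 0) (Subsingleton.strictMono _)
  naturality _ _ _ := rfl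

end InjDelta

section

variable {C : Type u} [Category.{v} C] (weq : MorphismProperty C)

/-- Homotopically constant co-`Δ`-objects. -/
def IsHomotopicallyConstant : ObjectProperty (CoDelta C) :=
  fun A => ∀ ⦃m n : InjDelta⦄ (α : m ⟶ n), weq (A.map α)

/-- The full subcategory of homotopically constant co-`Δ`-objects. -/
abbrev HomotopicallyConstantCat := (IsHomotopicallyConstant weq).FullSubcategory

/-- The level equivalences between homotopically constant co-`Δ`-objects. -/
def homotopicallyConstantEquivalences : MorphismProperty (HomotopicallyConstantCat weq) :=
  (levelEquivalences weq).inverseImage (IsHomotopicallyConstant weq).ι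

/-- Frames are homotopically constant. -/
abbrev frameInclusion (cof : MorphismProperty C) :
    FrameCat cof weq ⥤ HomotopicallyConstantCat weq :=
  ObjectProperty.ιOfLE fun _ h => h.2

/-- Precomposition with the cone functor. -/
def coneShift : HomotopicallyConstantCat weq ⥤ HomotopicallyConstantCat weq :=
  ObjectProperty.lift _
    ((IsHomotopicallyConstant weq).ι ⋙ (Functor.whiskeringLeft _ _ C).obj InjDelta.cone)
    fun A _ _ α => A.property (InjDelta.cone.map α)

/-- The evaluation in dimension `0` of homotopically constant co-`Δ`-objects. -/
abbrev homotopicallyConstantEvalZero : HomotopicallyConstantCat weq ⥤ C :=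
  (IsHomotopicallyConstant weq).ι ⋙ (evaluation InjDelta C).obj ⟨0⟩

/-- The transformation from a homotopically constant object to its cone shift. -/
def toConeShift : 𝟭 _ ⟶ coneShift weq where
  app A := ObjectProperty.homMk (Functor.whiskerRight toCone A.obj)
  naturality A B f := by
    ext n
    exact (f.hom.naturality _).symm

variable {weq} {cof : MorphismProperty C}

namespace IsCofibrationCategory

variable (hC : IsCofibrationCategory cof weq)
include hC

/-- Constant co-`Δ`-objects. -/
def constFunctor : C ⥤ HomotopicallyConstantCat weq :=
  ObjectProperty.lift _ (Functor.const InjDelta) fun X _ _ _ => hC.weq_id X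

/-- The transformation from the constant object on the value in dimension `0` to the cone shift. -/
def constToConeShift : homotopicallyConstantEvalZero weq ⋙ hC.constFunctor ⟶ coneShift weq where
  app A := ObjectProperty.homMk
    { app := fun n => A.obj.map (vertexToCone.app n)
      naturality := fun m n α => by
        have := congrArg A.obj.map (vertexToCone.naturality α)
        rw [Functor.map_comp, Functor.map_comp] at this
        refine Eq.trans ?_ this
        exact congrArg (· ≫ A.obj.map (vertexToCone.app n)) (A.obj.map_id _).symm }
  naturality A B f := by
    ext n
    exact (f.hom.naturality _).symm

theorem isCofibrantApproximation_frameInclusion :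
    IsCofibrantApproximation (frameCofibrations cof weq) (frameEquivalences cof weq)
      (homotopicallyConstantEquivalences weq) (frameInclusion weq cof) where
  isCofibrationCategory := hC.isCofibrationCategory_frameCat
  map_weq_iff _ _ _ := Iff.rfl
  two_out_of_three :=
    { comp_mem := fun _ _ hf hg n => hC.weq_comp (hf n) (hg n)
      of_postcomp := fun _ _ hg hfg n => hC.weq_of_postcomp (hg n) (hfg n)
      of_precomp := fun _ _ hf hfg n => hC.weq_of_precomp (hf n) (hfg n) }
  weq_id _ _ := hC.weq_id _
  map_initial X hX := by
    have h (n : InjDelta) := (hC.isInitial_obj hX.some n).some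
    refine ⟨IsInitial.ofUniqueHom (fun Y => ObjectProperty.homMk
      { app := fun n => (h n).to _
        naturality := fun m _ _ => (h m).hom_ext _ _ }) fun Y f => ?_⟩
    ext n
    exact (h n).hom_ext _ _
  map_pushout _ _ _ _ f i j g hi h :=
    IsPushout.of_map_of_faithful (IsHomotopicallyConstant weq).ι
      (IsPushout.of_forall_isPushout_app (hC.isPushout_frame_app h hi))
  exists_factorization A Y φ := by
    obtain ⟨Z, i, p, hi, hp, e⟩ := hC.exists_frame_factorization Y.property φ.hom
    exact ⟨Z, i, ObjectProperty.homMk p, hi, hp, by ext1; exact e⟩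

theorem isEquivalence_derivedFunctor_frameEvalZero
    (h : ∀ ⦃X Y : FrameCat cof weq⦄ (f : X ⟶ Y), frameEquivalences cof weq f →
      weq ((frameEvalZero cof weq).map f)) :
    (derivedFunctor (frameEvalZero cof weq) h).IsEquivalence := by
  have hI := hC.isCofibrantApproximation_frameInclusion
  let G := hI.approxFunctor
  have hG : ∀ ⦃X Y : C⦄ (f : X ⟶ Y), weq f → IsIso ((hC.constFunctor ⋙ G).map f) :=
    fun X Y f hf => hI.isIso_approxFunctor_map fun _ => hf
  have (A : HomotopicallyConstantCat weq) :
      IsIso ((Functor.whiskerRight hC.constToConeShift G).app A) :=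
    hI.isIso_approxFunctor_map fun _ => A.property _
  have : IsIso (Functor.whiskerRight hC.constToConeShift G) := NatIso.isIso_of_isIso_app _
  have (A : HomotopicallyConstantCat weq) :
      IsIso ((Functor.whiskerRight (toConeShift weq) G).app A) :=
    hI.isIso_approxFunctor_map fun _ => A.property _
  have : IsIso (Functor.whiskerRight (toConeShift weq) G) := NatIso.isIso_of_isIso_app _
  -- Both legs are structure morphisms of a homotopically constant object, hence level equivalences,
  -- which `G` inverts.
  let zigzag : (homotopicallyConstantEvalZero weq ⋙ hC.constFunctor) ⋙ G ≅ 𝟭 _ ⋙ G :=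
    asIso (Functor.whiskerRight hC.constToConeShift G) ≪≫
      (asIso (Functor.whiskerRight (toConeShift weq) G)).symm
  let E' := derivedFunctor (frameEvalZero cof weq) h
  have hE' : (frameEquivalences cof weq).Q ⋙ E' = frameEvalZero cof weq ⋙ weq.Q :=
    Localization.Construction.fac _ _
  let H := Localization.Construction.lift (hC.constFunctor ⋙ G) hG
  have hH : weq.Q ⋙ H = hC.constFunctor ⋙ G := Localization.Construction.fac _ _
  let : Localization.Lifting (frameEquivalences cof weq).Q (frameEquivalences cof weq)
    (frameEvalZero cof weq ⋙ weq.Q) E' := ⟨eqToIso hE'⟩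
  let : Localization.Lifting weq.Q weq (hC.constFunctor ⋙ G) H := ⟨eqToIso hH⟩
  refine Localization.isEquivalence (frameEquivalences cof weq).Q (frameEquivalences cof weq)
    weq.Q weq (frameEvalZero cof weq ⋙ weq.Q) E' (hC.constFunctor ⋙ G) H ?_ ?_
  -- On frames, the zigzag replaces the constant object on `A⁰` by `A`, whose approximation is `A`
  -- itself in the homotopy category.
  · exact Functor.associator _ _ _ ≪≫ Functor.isoWhiskerLeft (frameEvalZero cof weq) (eqToIso hH) ≪≫
      Functor.isoWhiskerLeft (frameInclusion weq cof) zigzag ≪≫ hI.approxFunctorRestriction.symm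
  -- Evaluating the approximation of `Y` in dimension `0` gives `Y⁰` up to a weak equivalence, and a
  -- constant object evaluates definitionally to its value.
  · exact Functor.associator _ _ _ ≪≫ Functor.isoWhiskerLeft hC.constFunctor
      (hI.approxFunctorCompIso E' (homotopicallyConstantEvalZero weq ⋙ weq.Q)
        (fun _ _ f hf => weq.Q_inverts _ (hf ⟨0⟩)) (eqToIso hE')) ≪≫ Iso.refl _

end IsCofibrationCategory

end

theorem mainTheorem5 {C : Type u} [Category.{v} C] (cof weq : MorphismProperty C)
    (hC : IsCofibrationCategory cof weq) :
    IsCofibrationCategory (frameCofibrations cof weq) (frameEquivalences cof weq) ∧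
      ∃ hexact : IsExactFunctor (frameCofibrations cof weq) (frameEquivalences cof weq) cof weq
          (frameEvalZero cof weq),
        (derivedFunctor (frameEvalZero cof weq) hexact.map_weq).IsEquivalence :=
  ⟨hC.isCofibrationCategory_frameCat, hC.isExactFunctor_frameEvalZero,
    hC.isEquivalence_derivedFunctor_frameEvalZero _⟩
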